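/- **Setting.** Let $1\le m\le d$ and let $\mathcal A$ be a nonempty family of $m$-element subsets ("actions") of the set of arms $[d]=\{1,\dots,d\}$; an action is identified with its indicator vector in $\{0,1\}^d$. The reward vectors $X_1,X_2,\dots\in\mathbb R^d$ are i.i.d. with mean $\mu$, and there is a positive semi-definite matrix $C$ with $\mathbb E[e^{u^\top(X_t-\mu)}]\le e^{\frac12u^\top Cu}$ for all $u\in\mathbb R^d$. Let $\Gamma$ be a known positive semi-definite matrix with non-negative entries such that $v^\top Cv\le v^\top\Gamma v$ for all vectors $v$ with positive coordinates. Let $A^*$ be an action maximizing $A^\top\mu$ over $\mathcal A$, and let $\Delta_A=A^{*\top}\mu-A^\top\mu$, $\Delta_{\max}=\max_{A\in\mathcal A}\Delta_A$, $\Delta_{\min}=\min\{\Delta_A:A\in\mathcal A,\ \Delta_A>0\}$ and $\Delta_{i,\min}=\min\{\Delta_A:A\in\mathcal A,\ i\in A,\ \Delta_A>0\}$, where $\Gamma^{(ii)}/\Delta_{i,\min}$ is read as $0$ if no suboptimal action contains $i$, and $\Delta_{\max}/\Delta_{\min}^2$ is read as $0$ if all actions are optimal. **Algorithm.** Let $\lambda>0$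 and $f(t)=\log t+(m+2)\log\log t+\frac m2\log(1+\frac e\lambda)$. OLS-UCB chooses the action $A_t\in\mathcal A$ of stage $t\ge1$ on the basis of the past, and then observes $X_t^{(i)}$ for $i\in A_t$. In an initialization phase, the stages $1,\dots,\tau$, it chooses arbitrary actions such that each arm is pulled at least once. At each stage $t>\tau$ it chooses, with ties broken arbitrarily, $$A_t\in\arg\max_{A\in\mathcal A}\ A^\top\hat\mu_t+\sqrt{2f(t)}\sqrt{A^\top D_t^{-1}\Big(\lambda\Sigma_\Gamma D_t+\sum_{s=1}^{t-1}I_{A_s}\Gamma I_{A_s}\Big)D_t^{-1}A},$$ where $\hat\mu_t^{(i)}$ is the average of the rewards $X_s^{(i)}$ over the stages $s<t$ with $i\in A_s$, $I_A$ is the diagonal matrix with diagonal $A$, $D_t=\sum_{s=1}^{t-1}I_{A_s}$, and $\Sigma_\Gamma$ is the diagonal part of $\Gamma$. **Theorem.** Let $\Delta_t=\Delta_{A_t}$ and $R_T=\sum_{t=1}^T\Delta_t$, and let $$\gamma=\max_{t\le T}\ \max_{i,j\in A_t,\ i\ne j}\frac{\Gamma^{(ij)}}{\sqrt{\Gamma^{(ii)}\Gamma^{(jj)}}}\in[0,1]$$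 (with $0/0=0$, and $\gamma=0$ if $m=1$). For every $T\ge1$, $$\begin{aligned}\mathbb E[R_T]\le{}&\mathbb E\Big[\sum_{t=1}^{\min(\tau,T)}\Delta_t\Big]+16f(T)^+\sum_{i\in[d]}\frac{\Gamma^{(ii)}}{\Delta_{i,\min}}\ \mathbb E\Big[5(\lambda+1-\gamma)\Big\lceil\frac{\log m}{1.6}\Big\rceil^2+45\gamma m\Big]\\&+\frac{8dm^2\max_i\{C^{(ii)}\}\Delta_{\max}}{\Delta_{\min}^2}+4\Delta_{\max},\end{aligned}$$ where $\lceil x\rceil$ is the smallest positive integer that is at least $x$ (so $\lceil0\rceil=1$) and $f(T)^+=\max(f(T),0)$, which equals $f(T)$ for all $T\ge3$ (for $T=1$, where $\log\log T$ is undefined, that term of $f$ is read as $0$). -/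

import Mathlib

open MeasureTheory ProbabilityTheory

noncomputable section

namespace SemiBandit

open scoped Matrix

/-- The set of available actions: a nonempty family of sets of exactly `m` arms among `d`. -/
structure ActionSet (d m : ℕ) where
  acts : Finset (Finset (Fin d))
  nonempty : acts.Nonempty
  card_eq : ∀ A ∈ acts, A.card = m

variable {d m : ℕ} {Ω : Type*}

/-- The mean reward `Aᵀ μ` of an action. -/
def meanReward (μ : Fin d → ℝ) (A : Finset (Fin d)) : ℝ := ∑ i ∈ A, μ i

/-- The gap `Δ_A = A*ᵀ μ - Aᵀ μ`, where `A*` is an action of maximal mean. -/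
def gap (𝒜 : ActionSet d m) (μ : Fin d → ℝ) (A : Finset (Fin d)) : ℝ :=
  𝒜.acts.sup' 𝒜.nonempty (meanReward μ) - meanReward μ A

/-- The largest gap. -/
def gapMax (𝒜 : ActionSet d m) (μ : Fin d → ℝ) : ℝ :=
  𝒜.acts.sup' 𝒜.nonempty (gap 𝒜 μ)

/-- The set of gaps of suboptimal actions. -/
def posGaps (𝒜 : ActionSet d m) (μ : Fin d → ℝ) : Set ℝ :=
  {x | ∃ A ∈ 𝒜.acts, 0 < gap 𝒜 μ A ∧ x = gap 𝒜 μ A}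

/-- The smallest gap of a suboptimal action. If there is no suboptimal action the value is
immaterial, because then `gapMax` vanishes. -/
def gapMin (𝒜 : ActionSet d m) (μ : Fin d → ℝ) : ℝ := sInf (posGaps 𝒜 μ)

/-- The gaps of the suboptimal actions that contain arm `i`. -/
def armPosGaps (𝒜 : ActionSet d m) (μ : Fin d → ℝ) (i : Fin d) : Set ℝ :=
  {x | ∃ A ∈ 𝒜.acts, i ∈ A ∧ 0 < gap 𝒜 μ A ∧ x = gap 𝒜 μ A}

/-- The minimal gap `Δ_{i,min}` of arm `i`, over the suboptimal actions that contain it. -/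
def armGapMin (𝒜 : ActionSet d m) (μ : Fin d → ℝ) (i : Fin d) : ℝ :=
  sInf (armPosGaps 𝒜 μ i)

/-- `∑ i, Γ^{(ii)} / Δ_{i,min}`, over the arms that belong to some suboptimal action (for the
other arms the minimum is over the empty set, `Δ_{i,min} = ∞`, and the term is `0`). -/
def complexity (𝒜 : ActionSet d m) (μ : Fin d → ℝ) (Γ : Matrix (Fin d) (Fin d) ℝ) : ℝ :=
  open Classical in
  ∑ i ∈ Finset.univ.filter (fun i => (armPosGaps 𝒜 μ i).Nonempty), Γ i i / armGapMin 𝒜 μ i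

/-- `C ⪯₊ Γ`. -/
def LePos (C Γ : Matrix (Fin d) (Fin d) ℝ) : Prop :=
  ∀ v : Fin d → ℝ, (∀ i, 0 < v i) → v ⬝ᵥ (C *ᵥ v) ≤ v ⬝ᵥ (Γ *ᵥ v)

/-- The reward vectors `X 1, X 2, …` are i.i.d. with mean `μ`, their noise has subgaussian
covariance matrix `C`, and `X (t + 1)` is independent of the information `ℱ t` that is available
after stage `t` (which contains `X 1, …, X t` and possibly external randomness). -/
structure IsRewardProcess [mΩ : MeasurableSpace Ω] (P : Measure Ω) (ℱ : Filtration ℕ mΩ)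
    (X : ℕ → Ω → Fin d → ℝ) (μ : Fin d → ℝ) (C : Matrix (Fin d) (Fin d) ℝ) : Prop where
  adapted : ∀ t, Measurable[ℱ (t + 1)] (X (t + 1))
  indep : ∀ t, Indep (MeasurableSpace.comap (X (t + 1)) inferInstance) (ℱ t) P
  identDistrib : ∀ t, 1 ≤ t → IdentDistrib (X t) (X 1) P P
  integrable : ∀ t, 1 ≤ t → ∀ i, Integrable (fun ω => X t ω i) P
  mean : ∀ t, 1 ≤ t → ∀ i, ∫ ω, X t ω i ∂P = μ i
  posSemidef : C.PosSemidef
  exp_integrable : ∀ t, 1 ≤ t → ∀ u : Fin d → ℝ,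
    Integrable (fun ω => Real.exp (u ⬝ᵥ (X t ω - μ))) P
  subgaussian : ∀ t, 1 ≤ t → ∀ u : Fin d → ℝ,
    ∫ ω, Real.exp (u ⬝ᵥ (X t ω - μ)) ∂P ≤ Real.exp ((1 / 2) * (u ⬝ᵥ (C *ᵥ u)))

/-- The indicator vector of an action in `{0,1}^d`. -/
def vec (A : Finset (Fin d)) : Fin d → ℝ := fun i => if i ∈ A then 1 else 0

/-- The diagonal matrix `I_A`. -/
def proj (A : Finset (Fin d)) : Matrix (Fin d) (Fin d) ℝ := Matrix.diagonal (vec A)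

/-- The number of pulls of arm `i` before stage `t`, along the sequence of actions `a 1, a 2, …`. -/
def pulls (a : ℕ → Finset (Fin d)) (t : ℕ) (i : Fin d) : ℕ :=
  ((Finset.Ico 1 t).filter (fun s => i ∈ a s)).card

/-- The diagonal matrix `D_t = ∑_{s < t} I_{A_s}` of the numbers of pulls. -/
def design (a : ℕ → Finset (Fin d)) (t : ℕ) : Matrix (Fin d) (Fin d) ℝ :=
  ∑ s ∈ Finset.Ico 1 t, proj (a s)

/-- The least squares estimator of the mean of arm `i` at stage `t`. -/
def muHat (a : ℕ → Finset (Fin d)) (x : ℕ → Fin d → ℝ) (t : ℕ) (i : Fin d) : ℝ :=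
  (∑ s ∈ (Finset.Ico 1 t).filter (fun s => i ∈ a s), x s i) / (pulls a t i : ℝ)

/-- `f(t) = log t + (m + 2) log log t + (m / 2) log (1 + e / lam)`. -/
def explore (m : ℕ) (lam : ℝ) (t : ℕ) : ℝ :=
  Real.log t + (m + 2) * Real.log (Real.log t) + (m / 2) * Real.log (1 + Real.exp 1 / lam)

/-- The exploration term
`E_t(A) = √(2 f(t)) √(Aᵀ D_t⁻¹ (lam Σ_Γ D_t + ∑_{s < t} Γ_{A_s}) D_t⁻¹ A)`,
where `Σ_Γ` is the diagonal part of `Γ` and `Γ_A = I_A Γ I_A`. -/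
def bonus (m : ℕ) (Γ : Matrix (Fin d) (Fin d) ℝ) (lam : ℝ) (a : ℕ → Finset (Fin d)) (t : ℕ)
    (A : Finset (Fin d)) : ℝ :=
  Real.sqrt (2 * explore m lam t) *
    Real.sqrt (vec A ⬝ᵥ
      (((design a t)⁻¹ *
        (lam • (Matrix.diagonal (fun i => Γ i i) * design a t) +
          ∑ s ∈ Finset.Ico 1 t, proj (a s) * Γ * proj (a s)) *
        (design a t)⁻¹) *ᵥ vec A))

/-- The index `Aᵀ μ̂_t + E_t(A)` of an action at stage `t`. -/
def index (m : ℕ) (Γ : Matrix (Fin d) (Fin d) ℝ) (lam : ℝ) (a : ℕ → Finset (Fin d))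
    (x : ℕ → Fin d → ℝ) (t : ℕ) (A : Finset (Fin d)) : ℝ :=
  (∑ i ∈ A, muHat a x t i) + bonus m Γ lam a t A

/-- The actions `A 1, A 2, …` are those of a run of OLS-UCB with matrix `Γ` and parameter `lam`:
the action of each stage is chosen from the information available before that stage; during an
initialization phase, the stages `1, …, τ`, the actions are arbitrary but such that each arm is
pulled at least once; at each later stage an action of maximal index is chosen, with ties broken
in any way. -/
structure IsOLSUCB [mΩ : MeasurableSpace Ω] (𝒜 : ActionSet d m)
    (Γ : Matrix (Fin d) (Fin d) ℝ) (lam : ℝ) (ℱ : Filtration ℕ mΩ) (X : ℕ → Ω → Fin d → ℝ)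
    (A : ℕ → Ω → Finset (Fin d)) (τ : Ω → ℕ) : Prop where
  mem : ∀ t, 1 ≤ t → ∀ ω, A t ω ∈ 𝒜.acts
  predictable : ∀ t B, MeasurableSet[ℱ t] {ω | A (t + 1) ω = B}
  stopping : ∀ k, MeasurableSet[ℱ k] {ω | τ ω ≤ k}
  init : ∀ ω i, ∃ s, 1 ≤ s ∧ s ≤ τ ω ∧ i ∈ A s ω
  argmax : ∀ ω t, τ ω < t → ∀ B ∈ 𝒜.acts,
    index m Γ lam (fun s => A s ω) (fun s => X s ω) t B ≤
      index m Γ lam (fun s => A s ω) (fun s => X s ω) t (A t ω)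

/-- The maximal off-diagonal correlation coefficient of `Γ_A`; it is `0` if `A` has one arm. -/
def corr (Γ : Matrix (Fin d) (Fin d) ℝ) (A : Finset (Fin d)) : ℝ :=
  ⨆ p : A.offDiag, Γ p.1.1 p.1.2 / Real.sqrt (Γ p.1.1 p.1.1 * Γ p.1.2 p.1.2)

/-- The maximum `γ` of the correlation coefficients of the actions of the stages `1, …, T`. -/
def maxCorr (Γ : Matrix (Fin d) (Fin d) ℝ) (a : ℕ → Finset (Fin d)) (T : ℕ) : ℝ :=
  ⨆ t : Finset.Icc 1 T, corr Γ (a t)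

/-- The smallest positive integer that is at least `x`. -/
def posCeil (x : ℝ) : ℕ := max 1 ⌈x⌉₊

/-- The regret accumulated during the first `T` stages of a run `a 1, a 2, …`. -/
def regret (𝒜 : ActionSet d m) (μ : Fin d → ℝ) (a : ℕ → Finset (Fin d)) (T : ℕ) : ℝ :=
  ∑ t ∈ Finset.Icc 1 T, gap 𝒜 μ (a t)

end SemiBandit

end

/-!
Mixing the exponential supermartingales of the noise over a Gaussian family of directions, and
peeling the pull counts of the optimal action geometrically, gives a self-normalized inequality:
the index of the optimal action falls below its mean at stage `t` with probability at most
`1 / (t log² t)`. The empirical mean of an arm deviates with a probability controlled separately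
for each number `n` of its pulls, the noise being truncated after `n` pulls. On the remaining good
stages the gap satisfies `Δ² ≤ 8 f (b x + γ y²)` with `b = λ + 1 - γ`, where `x = ∑ Γ_ii / N_i` and
`y = ∑ √(Γ_ii / N_i)` run over the arms of the action and `N_i` are the pull counts. Whichever of
the two terms dominates, `Δ` can be charged to those arms of the action whose counts are small.
Each stage that plays an arm raises its count, so the charges to arm `i` are summed over distinct
counts, and their total is at most a multiple of `Γ_ii / Δ_{i,min}`.
-/

noncomputable section

namespace SemiBandit

open scoped Matrix ENNReal

variable {d m : ℕ} {Ω : Type*}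

section Integrals

variable {E F : Type*} [MeasurableSpace E] [MeasurableSpace F] {𝓖 mΩ : MeasurableSpace Ω}
  {P : Measure Ω}

theorem lintegral_mul_comp_le_of_indep [IsFiniteMeasure P] (h𝓖 : 𝓖 ≤ mΩ)
    {X : Ω → F} (hX : Measurable X) (hindep : Indep (MeasurableSpace.comap X inferInstance) 𝓖 P)
    {Z : Ω → ℝ≥0∞} (hZ : Measurable[𝓖] Z) {U : Ω → E} (hU : Measurable[𝓖] U)
    {g : E × F → ℝ≥0∞} (hg : Measurable g) (hle : ∀ u, ∫⁻ ω, g (u, X ω) ∂P ≤ 1) :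
    ∫⁻ ω, Z ω * g (U ω, X ω) ∂P ≤ ∫⁻ ω, Z ω ∂P := by
  have hZ' : Measurable Z := hZ.mono h𝓖 le_rfl
  have hZU : Measurable (fun ω => (Z ω, U ω)) := hZ'.prodMk (hU.mono h𝓖 le_rfl)
  have hind : IndepFun (fun ω => (Z ω, U ω)) X P :=
    (indep_of_indep_of_le_right hindep (hZ.prodMk hU).comap_le).symm
  have hmap := (indepFun_iff_map_prod_eq_prod_map_map hZU.aemeasurable hX.aemeasurable).1 hind
  have hG : Measurable (fun q : (ℝ≥0∞ × E) × F => q.1.1 * g (q.1.2, q.2)) := by fun_prop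
  have hgX : ∀ u, ∫⁻ x, g (u, x) ∂P.map X ≤ 1 := fun u => by
    rw [lintegral_map (by fun_prop) hX]
    exact hle u
  calc ∫⁻ ω, Z ω * g (U ω, X ω) ∂P
      = ∫⁻ q, q.1.1 * g (q.1.2, q.2) ∂P.map (fun ω => ((Z ω, U ω), X ω)) :=
        (lintegral_map hG (hZU.prodMk hX)).symm
    _ = ∫⁻ z, z.1 * ∫⁻ x, g (z.2, x) ∂P.map X ∂P.map (fun ω => (Z ω, U ω)) := by
        rw [hmap, lintegral_prod _ hG.aemeasurable]
        exact lintegral_congr fun z =>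
          lintegral_const_mul z.1 (hg.comp (measurable_prodMk_left (x := z.2)))
    _ ≤ ∫⁻ z, z.1 ∂P.map (fun ω => (Z ω, U ω)) :=
        lintegral_mono fun z => mul_le_of_le_one_right' (hgX z.2)
    _ = ∫⁻ ω, Z ω ∂P := lintegral_map measurable_fst hZU

theorem measure_ofReal_inv_le_le {f : Ω → ℝ≥0∞} (hf : AEMeasurable f P) (hf1 : ∫⁻ ω, f ω ∂P ≤ 1)
    {c : ℝ} (hc : 0 < c) : P {ω | (ENNReal.ofReal c)⁻¹ ≤ f ω} ≤ ENNReal.ofReal c := by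
  have : ENNReal.ofReal c ≠ 0 := by simpa using hc
  calc P {ω | (ENNReal.ofReal c)⁻¹ ≤ f ω} ≤ (∫⁻ ω, f ω ∂P) / (ENNReal.ofReal c)⁻¹ :=
        meas_ge_le_lintegral_div hf (by simp) (by simpa using hc)
    _ ≤ 1 / (ENNReal.ofReal c)⁻¹ := by gcongr
    _ = ENNReal.ofReal c := by rw [one_div, inv_inv]

theorem ofReal_integral_le_lintegral {f : Ω → ℝ} (hf : Integrable f P) :
    ENNReal.ofReal (∫ ω, f ω ∂P) ≤ ∫⁻ ω, ENNReal.ofReal (f ω) ∂P := by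
  rw [integral_eq_lintegral_pos_part_sub_lintegral_neg_part hf]
  exact (ENNReal.ofReal_le_ofReal (sub_le_self _ ENNReal.toReal_nonneg)).trans
    ENNReal.ofReal_toReal_le

end Integrals

section Gaussian

variable {ι : Type*} [Fintype ι]

/-- The unnormalized density of the centered Gaussian vector with independent coordinates of
precisions `q`. -/
def gaussWeight (q g : ι → ℝ) : ℝ := ∏ i, Real.exp (-(q i / 2) * g i ^ 2)

theorem gaussWeight_pos (q g : ι → ℝ) : 0 < gaussWeight q g :=
  Finset.prod_pos fun _ _ => Real.exp_pos _

@[fun_prop]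
theorem measurable_gaussWeight (q : ι → ℝ) : Measurable (gaussWeight q) := by
  unfold gaussWeight
  fun_prop

theorem integral_gaussWeight (q : ι → ℝ) :
    ∫ g, gaussWeight q g = ∏ i, √(2 * Real.pi / q i) := by
  unfold gaussWeight
  rw [integral_fintype_prod_volume_eq_prod (f := fun i x => Real.exp (-(q i / 2) * x ^ 2))]
  refine Finset.prod_congr rfl fun i _ => ?_
  rw [integral_gaussian, div_div_eq_mul_div, mul_comm]

theorem integrable_prod_pow_mul_gaussWeight {q : ι → ℝ} (hq : ∀ i, 0 < q i) (e : ι → ℕ) :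
    Integrable (fun g : ι → ℝ => (∏ i, g i ^ e i) * gaussWeight q g) := by
  simp only [gaussWeight, ← Finset.prod_mul_distrib]
  refine Integrable.fintype_prod (f := fun i x => x ^ e i * Real.exp (-(q i / 2) * x ^ 2))
    fun i => ?_
  simpa only [Real.rpow_natCast] using integrable_rpow_mul_exp_neg_mul_sq (half_pos (hq i))
    (neg_one_lt_zero.trans_le (Nat.cast_nonneg (e i)))

theorem integral_prod_pow_mul_gaussWeight_eq_zero (q : ι → ℝ) {e : ι → ℕ} {k : ι}
    (hk : Odd (e k)) : ∫ g : ι → ℝ, (∏ i, g i ^ e i) * gaussWeight q g = 0 := by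
  simp only [gaussWeight, ← Finset.prod_mul_distrib]
  rw [integral_fintype_prod_volume_eq_prod
    (f := fun i x => x ^ e i * Real.exp (-(q i / 2) * x ^ 2))]
  refine Finset.prod_eq_zero (Finset.mem_univ k) ?_
  have h := integral_neg_eq_self (fun x : ℝ => x ^ e k * Real.exp (-(q k / 2) * x ^ 2)) volume
  simp only [hk.neg_pow, even_two, Even.neg_pow, neg_mul, integral_neg] at h ⊢
  linarith

theorem integrable_gaussWeight {q : ι → ℝ} (hq : ∀ i, 0 < q i) : Integrable (gaussWeight q) := by
  simpa using integrable_prod_pow_mul_gaussWeight hq 0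

theorem prod_pow_single_one [DecidableEq ι] (g : ι → ℝ) (i : ι) :
    ∏ k, g k ^ (Pi.single i 1 : ι → ℕ) k = g i := by
  rw [Finset.prod_eq_single i (fun k _ hk => by simp [hk]) (by simp)]
  simp

theorem integrable_dotProduct_mul_gaussWeight {q : ι → ℝ} (hq : ∀ i, 0 < q i) (l : ι → ℝ) :
    Integrable (fun g => (l ⬝ᵥ g) * gaussWeight q g) := by
  classical
  simp only [dotProduct, Finset.sum_mul, mul_assoc]
  refine integrable_finsetSum _ fun i _ => Integrable.const_mul ?_ _
  simpa only [prod_pow_single_one] using integrable_prod_pow_mul_gaussWeight hq (Pi.single i 1)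

theorem integral_dotProduct_mul_gaussWeight (q l : ι → ℝ) :
    ∫ g, (l ⬝ᵥ g) * gaussWeight q g = 0 := by
  have h := integral_neg_eq_self (fun g : ι → ℝ => (l ⬝ᵥ g) * gaussWeight q g) volume
  simp only [dotProduct_neg, gaussWeight, Pi.neg_apply, even_two, Even.neg_pow, neg_mul,
    integral_neg] at h ⊢
  linarith

theorem prod_pow_single_add_single [DecidableEq ι] (g : ι → ℝ) (i j : ι) :
    ∏ k, g k ^ (Pi.single i 1 + Pi.single j 1 : ι → ℕ) k = g i * g j := by
  simp only [Pi.add_apply, pow_add, Finset.prod_mul_distrib, prod_pow_single_one]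

theorem quadratic_mul_eq_sum (N : Matrix ι ι ℝ) (g : ι → ℝ) (c : ℝ) :
    (g ⬝ᵥ (N *ᵥ g)) * c = ∑ i, ∑ j, N i j * (g i * g j * c) := by
  simp only [dotProduct, Matrix.mulVec, Finset.mul_sum, Finset.sum_mul]
  exact Finset.sum_congr rfl fun i _ => Finset.sum_congr rfl fun j _ => by ring

theorem integrable_quadratic_mul_gaussWeight {q : ι → ℝ} (hq : ∀ i, 0 < q i) (N : Matrix ι ι ℝ) :
    Integrable (fun g => (g ⬝ᵥ (N *ᵥ g)) * gaussWeight q g) := by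
  classical
  simp only [quadratic_mul_eq_sum, ← prod_pow_single_add_single]
  exact integrable_finsetSum _ fun i _ => integrable_finsetSum _ fun j _ =>
    (integrable_prod_pow_mul_gaussWeight hq _).const_mul _

theorem integral_quadratic_mul_gaussWeight_eq_zero {q : ι → ℝ} (hq : ∀ i, 0 < q i)
    {N : Matrix ι ι ℝ} (hN : ∀ i, N i i = 0) :
    ∫ g, (g ⬝ᵥ (N *ᵥ g)) * gaussWeight q g = 0 := by
  classical
  have hint (i j : ι) := (integrable_prod_pow_mul_gaussWeight hq
    (Pi.single i 1 + Pi.single j 1)).const_mul (N i j)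
  simp only [quadratic_mul_eq_sum, ← prod_pow_single_add_single]
  rw [integral_finsetSum _ fun i _ => integrable_finsetSum _ fun j _ => hint i j]
  refine Finset.sum_eq_zero fun i _ => ?_
  rw [integral_finsetSum _ fun j _ => hint i j]
  refine Finset.sum_eq_zero fun j _ => ?_
  rw [integral_const_mul]
  obtain rfl | hij := eq_or_ne i j
  · rw [hN, zero_mul]
  · rw [integral_prod_pow_mul_gaussWeight_eq_zero q (k := i) (by simp [hij]), mul_zero]

theorem integrable_one_add_linear_sub_quadratic_mul_gaussWeight {q : ι → ℝ} (hq : ∀ i, 0 < q i)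
    (l : ι → ℝ) (N : Matrix ι ι ℝ) :
    Integrable (fun g => (1 + (l ⬝ᵥ g - 1 / 2 * (g ⬝ᵥ (N *ᵥ g)))) * gaussWeight q g) := by
  simp only [add_mul, sub_mul, one_mul, mul_assoc]
  exact (integrable_gaussWeight hq).add ((integrable_dotProduct_mul_gaussWeight hq l).sub
    ((integrable_quadratic_mul_gaussWeight hq N).const_mul _))

theorem integral_one_add_linear_sub_quadratic_mul_gaussWeight {q : ι → ℝ} (hq : ∀ i, 0 < q i)
    (l : ι → ℝ) {N : Matrix ι ι ℝ} (hN : ∀ i, N i i = 0) :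
    ∫ g, (1 + (l ⬝ᵥ g - 1 / 2 * (g ⬝ᵥ (N *ᵥ g)))) * gaussWeight q g =
      ∏ i, √(2 * Real.pi / q i) := by
  have hlin := integrable_dotProduct_mul_gaussWeight hq l
  have hquad := (integrable_quadratic_mul_gaussWeight hq N).const_mul (1 / 2)
  have hsub : Integrable (fun g => (l ⬝ᵥ g) * gaussWeight q g -
      1 / 2 * ((g ⬝ᵥ (N *ᵥ g)) * gaussWeight q g)) := hlin.sub hquad
  simp only [add_mul, sub_mul, one_mul, mul_assoc]
  rw [integral_add (integrable_gaussWeight hq) hsub, integral_sub hlin hquad,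
    integral_const_mul, integral_dotProduct_mul_gaussWeight,
    integral_quadratic_mul_gaussWeight_eq_zero hq hN, integral_gaussWeight]
  ring

theorem gaussWeight_eq_exp [DecidableEq ι] (q g : ι → ℝ) :
    gaussWeight q g = Real.exp (-(1 / 2 * (g ⬝ᵥ (Matrix.diagonal q *ᵥ g)))) := by
  simp only [gaussWeight, ← Real.exp_sum, Matrix.mulVec_diagonal, dotProduct, Finset.mul_sum,
    ← Finset.sum_neg_distrib]
  exact congrArg Real.exp (Finset.sum_congr rfl fun i _ => by ring)

-- Recentering at `w` and using `1 + x ≤ exp x`, only the diagonal part of `M` survives integration.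
theorem ofReal_exp_mul_prod_sqrt_le_lintegral_exp {M : Matrix ι ι ℝ} (hM : ∀ i, 0 < M i i)
    (S w : ι → ℝ) :
    ENNReal.ofReal (Real.exp (w ⬝ᵥ S - 1 / 2 * (w ⬝ᵥ (M *ᵥ w))) * ∏ i, √(2 * Real.pi / M i i)) ≤
      ∫⁻ u, ENNReal.ofReal (Real.exp (u ⬝ᵥ S - 1 / 2 * (u ⬝ᵥ (M *ᵥ u)))) := by
  classical
  obtain ⟨q, hq⟩ : ∃ q : ι → ℝ, ∀ i, q i = M i i := ⟨_, fun _ => rfl⟩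
  set N := M - Matrix.diagonal q with hN
  set l := S - (1 / 2 : ℝ) • (w ᵥ* M + M *ᵥ w) with hl
  set c := Real.exp (w ⬝ᵥ S - 1 / 2 * (w ⬝ᵥ (M *ᵥ w)))
  have hq0 : ∀ i, 0 < q i := fun i => (hq i).symm ▸ hM i
  have hN0 : ∀ i, N i i = 0 := fun i => by simp [hN, hq]
  have hexp (g : ι → ℝ) :
      Real.exp ((w + g) ⬝ᵥ S - 1 / 2 * ((w + g) ⬝ᵥ (M *ᵥ (w + g)))) =
        c * (Real.exp (l ⬝ᵥ g - 1 / 2 * (g ⬝ᵥ (N *ᵥ g))) * gaussWeight q g) := by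
    rw [gaussWeight_eq_exp, ← Real.exp_add, ← Real.exp_add]
    congr 1
    simp only [hl, hN, add_dotProduct, sub_dotProduct, dotProduct_add, dotProduct_sub,
      smul_dotProduct, Matrix.mulVec_add, Matrix.sub_mulVec, ← Matrix.dotProduct_mulVec,
      dotProduct_comm g S, dotProduct_comm (M *ᵥ w) g, smul_eq_mul]
    ring
  have hint := (integrable_one_add_linear_sub_quadratic_mul_gaussWeight hq0 l N).const_mul c
  have heq := integral_one_add_linear_sub_quadratic_mul_gaussWeight hq0 l hN0
  simp only [hq] at heq
  rw [← heq, ← integral_const_mul, ← lintegral_add_left_eq_self _ w]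
  refine (ofReal_integral_le_lintegral hint).trans
    (lintegral_mono fun g => ENNReal.ofReal_le_ofReal ?_)
  rw [hexp]
  have hone := Real.add_one_le_exp (l ⬝ᵥ g - 1 / 2 * (g ⬝ᵥ (N *ᵥ g)))
  have := gaussWeight_pos q g
  gcongr
  linarith

end Gaussian

section SelfNormalized

variable {ι : Type*} [Fintype ι]

/-- The density of the centered Gaussian vector with independent coordinates of precisions `p`. -/
def gaussDensity (p u : ι → ℝ) : ℝ := (∏ i, √(p i / (2 * Real.pi))) * gaussWeight p u

theorem gaussDensity_nonneg (p u : ι → ℝ) : 0 ≤ gaussDensity p u :=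
  mul_nonneg (Finset.prod_nonneg fun _ _ => Real.sqrt_nonneg _) (gaussWeight_pos p u).le

@[fun_prop]
theorem measurable_gaussDensity (p : ι → ℝ) : Measurable (gaussDensity p) := by
  unfold gaussDensity
  fun_prop

theorem lintegral_gaussDensity {p : ι → ℝ} (hp : ∀ i, 0 < p i) :
    ∫⁻ u, ENNReal.ofReal (gaussDensity p u) = 1 := by
  have hint : Integrable (gaussDensity p) := (integrable_gaussWeight hp).const_mul _
  rw [← ofReal_integral_eq_lintegral_ofReal hint (.of_forall (gaussDensity_nonneg p)),
    ENNReal.ofReal_eq_one]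
  simp only [gaussDensity]
  rw [integral_const_mul, integral_gaussWeight, ← Finset.prod_mul_distrib]
  refine Finset.prod_eq_one fun i _ => ?_
  have := hp i
  rw [← Real.sqrt_mul (by positivity), Real.sqrt_eq_one]
  field_simp

theorem ofReal_exp_mul_prod_sqrt_le_lintegral_gaussDensity [DecidableEq ι] {p : ι → ℝ}
    (hp : ∀ i, 0 < p i) {V : Matrix ι ι ℝ} (hV : ∀ i, 0 ≤ V i i) (S w : ι → ℝ) :
    ENNReal.ofReal (Real.exp (w ⬝ᵥ S - 1 / 2 * (w ⬝ᵥ ((V + Matrix.diagonal p) *ᵥ w))) *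
        ∏ i, √(p i / (V i i + p i))) ≤
      ∫⁻ u, ENNReal.ofReal (Real.exp (u ⬝ᵥ S - 1 / 2 * (u ⬝ᵥ (V *ᵥ u))) * gaussDensity p u) := by
  have hM (i : ι) : (V + Matrix.diagonal p) i i = V i i + p i := by simp
  have hpos (i : ι) : 0 < V i i + p i := add_pos_of_nonneg_of_pos (hV i) (hp i)
  set c := ∏ i, √(p i / (2 * Real.pi))
  have hprod : ∏ i, √(p i / (V i i + p i)) = c * ∏ i, √(2 * Real.pi / (V i i + p i)) := by
    rw [← Finset.prod_mul_distrib]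
    refine Finset.prod_congr rfl fun i _ => ?_
    rw [← Real.sqrt_mul (div_nonneg (hp i).le (by positivity))]
    congr 1
    field_simp
  have hdens (u : ι → ℝ) :
      Real.exp (u ⬝ᵥ S - 1 / 2 * (u ⬝ᵥ (V *ᵥ u))) * gaussDensity p u =
        c * Real.exp (u ⬝ᵥ S - 1 / 2 * (u ⬝ᵥ ((V + Matrix.diagonal p) *ᵥ u))) := by
    rw [gaussDensity, gaussWeight_eq_exp, mul_left_comm, ← Real.exp_add, Matrix.add_mulVec,
      dotProduct_add]
    congr 2
    ring
  have hc : 0 ≤ c := Finset.prod_nonneg fun _ _ => Real.sqrt_nonneg _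
  have key := ofReal_exp_mul_prod_sqrt_le_lintegral_exp (fun i => (hM i).symm ▸ hpos i) S w
  simp only [hM] at key
  simp only [hdens, hprod, ENNReal.ofReal_mul hc]
  rw [lintegral_const_mul' _ _ ENNReal.ofReal_ne_top, mul_left_comm, ENNReal.ofReal_mul hc]
  gcongr

theorem exists_le_dotProduct_sub_half_quadratic {M : Matrix ι ι ℝ} (hM : M.PosDef)
    {S v : ι → ℝ} {f : ℝ} (hv : 2 * f * (v ⬝ᵥ (M *ᵥ v)) < (v ⬝ᵥ S) ^ 2) :
    ∃ w : ι → ℝ, f ≤ w ⬝ᵥ S - 1 / 2 * (w ⬝ᵥ (M *ᵥ w)) := by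
  have hv0 : v ≠ 0 := by
    rintro rfl
    simp at hv
  have hQ : 0 < v ⬝ᵥ (M *ᵥ v) := by simpa using hM.dotProduct_mulVec_pos hv0
  set Q := v ⬝ᵥ (M *ᵥ v)
  set y := v ⬝ᵥ S
  refine ⟨(y / Q) • v, ?_⟩
  simp only [smul_dotProduct, Matrix.mulVec_smul, dotProduct_smul, smul_eq_mul]
  calc f ≤ y ^ 2 / (2 * Q) := (le_div_iff₀ (by positivity)).2 (by linarith)
    _ = y / Q * y - 1 / 2 * (y / Q * (y / Q * Q)) := by field_simp; ring

/-- Canonical pairs of the theory of self-normalized processes: a random vector `S` and a random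
positive semidefinite matrix `V` with `E [exp (uᵀ S - uᵀ V u / 2)] ≤ 1` for all `u`. -/
structure IsCanonicalPair [MeasurableSpace Ω] (P : Measure Ω) (S : Ω → ι → ℝ)
    (V : Ω → Matrix ι ι ℝ) : Prop where
  measurable_left : ∀ i, Measurable fun ω => S ω i
  measurable_right : ∀ i j, Measurable fun ω => V ω i j
  posSemidef : ∀ ω, (V ω).PosSemidef
  lintegral_exp_le_one : ∀ u : ι → ℝ,
    ∫⁻ ω, ENNReal.ofReal (Real.exp (u ⬝ᵥ S ω - 1 / 2 * (u ⬝ᵥ (V ω *ᵥ u)))) ∂P ≤ 1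

namespace IsCanonicalPair

variable [MeasurableSpace Ω] {P : Measure Ω} {S : Ω → ι → ℝ} {V : Ω → Matrix ι ι ℝ}

theorem measurable_exp (h : IsCanonicalPair P S V) :
    Measurable fun z : Ω × (ι → ℝ) =>
      Real.exp (z.2 ⬝ᵥ S z.1 - 1 / 2 * (z.2 ⬝ᵥ (V z.1 *ᵥ z.2))) := by
  have hS (i : ι) : Measurable fun z : Ω × (ι → ℝ) => S z.1 i :=
    (h.measurable_left i).comp measurable_fst
  have hV (i j : ι) : Measurable fun z : Ω × (ι → ℝ) => V z.1 i j :=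
    (h.measurable_right i j).comp measurable_fst
  have hu (i : ι) : Measurable fun z : Ω × (ι → ℝ) => z.2 i :=
    (measurable_pi_apply i).comp measurable_snd
  simp only [dotProduct, Matrix.mulVec]
  exact ((Finset.measurable_sum _ fun i _ => (hu i).mul (hS i)).sub
    ((Finset.measurable_sum _ fun i _ => (hu i).mul
      (Finset.measurable_sum _ fun j _ => (hV i j).mul (hu j))).const_mul _)).exp

theorem conj {κ : Type*} [Fintype κ] (h : IsCanonicalPair P S V) (L : Matrix κ ι ℝ) :
    IsCanonicalPair P (fun ω => L *ᵥ S ω) (fun ω => L * V ω * Lᵀ) where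
  measurable_left k := by
    have := h.measurable_left
    simp only [Matrix.mulVec, dotProduct]
    fun_prop
  measurable_right k l := by
    have := h.measurable_right
    simp only [Matrix.mul_apply]
    fun_prop
  posSemidef ω := by simpa using (h.posSemidef ω).mul_mul_conjTranspose_same L
  lintegral_exp_le_one u := by
    refine le_of_eq_of_le (lintegral_congr fun ω => ?_) (h.lintegral_exp_le_one (u ᵥ* L))
    simp only [← Matrix.mulVec_mulVec, Matrix.dotProduct_mulVec, Matrix.mulVec_transpose]

theorem measurable_mixture (h : IsCanonicalPair P S V) (p : ι → ℝ) :
    Measurable fun ω => ∫⁻ u, ENNReal.ofReal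
      (Real.exp (u ⬝ᵥ S ω - 1 / 2 * (u ⬝ᵥ (V ω *ᵥ u))) * gaussDensity p u) := by
  have := h.measurable_exp
  exact Measurable.lintegral_prod_right' (f := fun z : Ω × (ι → ℝ) => ENNReal.ofReal
    (Real.exp (z.2 ⬝ᵥ S z.1 - 1 / 2 * (z.2 ⬝ᵥ (V z.1 *ᵥ z.2))) * gaussDensity p z.2))
    (by fun_prop)

theorem lintegral_mixture_le_one [SFinite P] (h : IsCanonicalPair P S V) {p : ι → ℝ}
    (hp : ∀ i, 0 < p i) :
    ∫⁻ ω, (∫⁻ u, ENNReal.ofReal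
      (Real.exp (u ⬝ᵥ S ω - 1 / 2 * (u ⬝ᵥ (V ω *ᵥ u))) * gaussDensity p u)) ∂P ≤ 1 := by
  have := h.measurable_exp
  rw [lintegral_lintegral_swap (by fun_prop), ← lintegral_gaussDensity hp]
  refine lintegral_mono fun u => ?_
  simp_rw [ENNReal.ofReal_mul (Real.exp_nonneg _)]
  rw [lintegral_mul_const' _ _ ENNReal.ofReal_ne_top]
  exact mul_le_of_le_one_left' (h.lintegral_exp_le_one u)

theorem measure_lt_sq_le_of_pos [SFinite P] [DecidableEq ι] (h : IsCanonicalPair P S V)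
    {p κ : ι → ℝ} (hp : ∀ i, 0 < p i) (hκ : ∀ i, 0 ≤ κ i) (f : ℝ) :
    P {ω | (∀ i, V ω i i ≤ κ i * p i) ∧
        ∃ v, 2 * f * (v ⬝ᵥ ((V ω + Matrix.diagonal p) *ᵥ v)) < (v ⬝ᵥ S ω) ^ 2} ≤
      ENNReal.ofReal (Real.exp (-f) * ∏ i, √(1 + κ i)) := by
  have hκ' (i : ι) : 0 < 1 + κ i := by linarith [hκ i]
  have hc : 0 < Real.exp (-f) * ∏ i, √(1 + κ i) :=
    mul_pos (Real.exp_pos _) (Finset.prod_pos fun i _ => Real.sqrt_pos.2 (hκ' i))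
  refine (measure_mono ?_).trans (measure_ofReal_inv_le_le
    (h.measurable_mixture p).aemeasurable (h.lintegral_mixture_le_one hp) hc)
  rintro ω ⟨hV, v, hv⟩
  have hV0 (i : ι) : 0 ≤ V ω i i := (h.posSemidef ω).diag_nonneg
  obtain ⟨w, hw⟩ := exists_le_dotProduct_sub_half_quadratic
    (Matrix.PosDef.posSemidef_add (h.posSemidef ω) (Matrix.PosDef.diagonal hp)) hv
  refine le_trans ?_ (ofReal_exp_mul_prod_sqrt_le_lintegral_gaussDensity hp hV0 (S ω) w)
  rw [← ENNReal.ofReal_inv_of_pos hc, mul_inv, ← Real.exp_neg, neg_neg,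
    ← Finset.prod_inv_distrib]
  refine ENNReal.ofReal_le_ofReal (mul_le_mul (Real.exp_le_exp.2 hw) ?_
    (Finset.prod_nonneg fun i _ => by positivity) (Real.exp_nonneg _))
  refine Finset.prod_le_prod (fun i _ => by positivity) fun i _ => ?_
  rw [← Real.sqrt_inv]
  refine Real.sqrt_le_sqrt ?_
  rw [inv_eq_one_div, div_le_div_iff₀ (hκ' i) (add_pos_of_nonneg_of_pos (hV0 i) (hp i))]
  linarith [hV i]

theorem measure_lt_sq_le [SFinite P] [DecidableEq ι] (h : IsCanonicalPair P S V)
    {p κ : ι → ℝ} (hp : ∀ i, 0 ≤ p i) (hκ : ∀ i, 0 ≤ κ i) {f : ℝ} (hf : 0 ≤ f) :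
    P {ω | (∀ i, V ω i i ≤ κ i * p i) ∧
        ∃ v, 2 * f * (v ⬝ᵥ ((V ω + Matrix.diagonal p) *ᵥ v)) < (v ⬝ᵥ S ω) ^ 2} ≤
      ENNReal.ofReal (Real.exp (-f) * ∏ i, √(1 + κ i)) := by
  let pert (n : ℕ) : ι → ℝ := fun i => p i + 1 / (n + 1)
  let E (n : ℕ) : Set Ω := {ω | (∀ i, V ω i i ≤ κ i * p i) ∧
    ∃ v, 2 * f * (v ⬝ᵥ ((V ω + Matrix.diagonal (pert n)) *ᵥ v)) < (v ⬝ᵥ S ω) ^ 2}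
  have hpert (n : ℕ) (M : Matrix ι ι ℝ) (v : ι → ℝ) :
      v ⬝ᵥ ((M + Matrix.diagonal (pert n)) *ᵥ v) =
        v ⬝ᵥ ((M + Matrix.diagonal p) *ᵥ v) + 1 / (n + 1) * (v ⬝ᵥ v) := by
    have hdiag : Matrix.diagonal (pert n) =
        Matrix.diagonal p + (1 / (n + 1) : ℝ) • (1 : Matrix ι ι ℝ) := by
      rw [← Matrix.diagonal_one, ← Matrix.diagonal_smul, Matrix.diagonal_add]
      simp [pert]
    rw [hdiag, ← add_assoc, Matrix.add_mulVec, dotProduct_add, Matrix.smul_mulVec,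
      Matrix.one_mulVec, dotProduct_smul, smul_eq_mul]
  have hmono : Monotone E := by
    rintro n k hnk ω ⟨hV, v, hv⟩
    refine ⟨hV, v, lt_of_le_of_lt ?_ hv⟩
    have := dotProduct_self_star_nonneg v
    rw [star_trivial] at this
    rw [hpert, hpert]
    gcongr
  have hsub : {ω | (∀ i, V ω i i ≤ κ i * p i) ∧
      ∃ v, 2 * f * (v ⬝ᵥ ((V ω + Matrix.diagonal p) *ᵥ v)) < (v ⬝ᵥ S ω) ^ 2} ⊆ ⋃ n, E n := by
    rintro ω ⟨hV, v, hv⟩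
    have hlim : Filter.Tendsto (fun n : ℕ => 2 * f * (v ⬝ᵥ ((V ω + Matrix.diagonal p) *ᵥ v) +
        1 / ((n : ℝ) + 1) * (v ⬝ᵥ v))) Filter.atTop
        (nhds (2 * f * (v ⬝ᵥ ((V ω + Matrix.diagonal p) *ᵥ v) + 0 * (v ⬝ᵥ v)))) :=
      ((tendsto_one_div_add_atTop_nhds_zero_nat.mul_const _).const_add _).const_mul _
    obtain ⟨n, hn⟩ := (hlim.eventually_lt_const (by simpa using hv)).exists
    exact Set.mem_iUnion.2 ⟨n, hV, v, by rwa [hpert]⟩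
  refine (measure_mono hsub).trans ?_
  rw [hmono.measure_iUnion]
  refine iSup_le fun n => (measure_mono ?_).trans
    (h.measure_lt_sq_le_of_pos (p := pert n)
      (fun i => add_pos_of_nonneg_of_pos (hp i) (Nat.one_div_pos_of_nat)) hκ f)
  exact fun ω ⟨hV, hv⟩ => ⟨fun i => (hV i).trans (mul_le_mul_of_nonneg_left
    (le_add_of_nonneg_right Nat.one_div_pos_of_nat.le) (hκ i)), hv⟩

theorem measure_supported_lt_sq_le [SFinite P] {d : ℕ} {S : Ω → Fin d → ℝ}
    {V : Ω → Matrix (Fin d) (Fin d) ℝ} (h : IsCanonicalPair P S V) (B : Finset (Fin d))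
    {p : Fin d → ℝ} (hp : ∀ i, 0 ≤ p i) {κ : ℝ} (hκ : 0 ≤ κ) {f : ℝ} (hf : 0 ≤ f) :
    P {ω | (∀ i ∈ B, V ω i i ≤ κ * p i) ∧ ∃ v, proj B *ᵥ v = v ∧
        2 * f * (v ⬝ᵥ ((V ω + Matrix.diagonal p) *ᵥ v)) < (v ⬝ᵥ S ω) ^ 2} ≤
      ENNReal.ofReal (Real.exp (-f) * √(1 + κ) ^ B.card) := by
  have hprod : ∏ i, √(1 + κ * vec B i) = √(1 + κ) ^ B.card := by
    have hterm (i : Fin d) : √(1 + κ * vec B i) = if i ∈ B then √(1 + κ) else 1 := by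
      by_cases hi : i ∈ B <;> simp [vec, hi]
    simp only [hterm, Finset.prod_ite_mem, Finset.univ_inter, Finset.prod_const]
  rw [← hprod]
  refine (measure_mono ?_).trans ((h.conj (proj B)).measure_lt_sq_le hp
    (fun i => mul_nonneg hκ (?_ : 0 ≤ vec B i)) hf)
  · rintro ω ⟨hV, v, hvB, hv⟩
    have hvB' : v ᵥ* proj B = v := by
      rwa [← Matrix.mulVec_transpose, proj, Matrix.diagonal_transpose]
    refine ⟨fun i => ?_, v, ?_⟩
    · by_cases hi : i ∈ B
      · simpa [proj, vec, hi] using hV i hi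
      · simp [proj, vec, hi]
    · simp only [Matrix.add_mulVec, dotProduct_add, ← Matrix.mulVec_mulVec, proj,
        Matrix.diagonal_transpose] at hv hvB hvB' ⊢
      simpa only [hvB, Matrix.dotProduct_mulVec _ (Matrix.diagonal (vec B)), hvB'] using hv
  · unfold vec
    positivity

end IsCanonicalPair

end SelfNormalized

section Noise

/-- The vector of the sums, over the pulls before stage `t`, of the noises of the arms. -/
def noiseSum (μ : Fin d → ℝ) (a : ℕ → Finset (Fin d)) (x : ℕ → Fin d → ℝ) (t : ℕ) : Fin d → ℝ :=
  ∑ s ∈ Finset.Ico 1 t, proj (a s) *ᵥ (x s - μ)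

/-- The accumulated covariance `∑_{s < t} I_{A_s} C I_{A_s}` of the semi-bandit observations. -/
def covSum (C : Matrix (Fin d) (Fin d) ℝ) (a : ℕ → Finset (Fin d)) (t : ℕ) :
    Matrix (Fin d) (Fin d) ℝ :=
  ∑ s ∈ Finset.Ico 1 t, proj (a s) * C * proj (a s)

/-- The reward vectors `X 1, X 2, …` are independent, each independent of the information that is
available before its stage, and their deviations from `μ` have subgaussian covariance matrix `C`;
they need not be identically distributed. Subgaussianity forces each of them to have mean `μ`. -/
structure IsSubgaussianProcess [mΩ : MeasurableSpace Ω] (P : Measure Ω) (ℱ : Filtration ℕ mΩ)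
    (X : ℕ → Ω → Fin d → ℝ) (μ : Fin d → ℝ) (C : Matrix (Fin d) (Fin d) ℝ) : Prop where
  adapted : ∀ t, Measurable[ℱ (t + 1)] (X (t + 1))
  indep : ∀ t, Indep (MeasurableSpace.comap (X (t + 1)) inferInstance) (ℱ t) P
  posSemidef : C.PosSemidef
  exp_integrable : ∀ t, 1 ≤ t → ∀ u : Fin d → ℝ,
    Integrable (fun ω => Real.exp (u ⬝ᵥ (X t ω - μ))) P
  subgaussian : ∀ t, 1 ≤ t → ∀ u : Fin d → ℝ,
    ∫ ω, Real.exp (u ⬝ᵥ (X t ω - μ)) ∂P ≤ Real.exp ((1 / 2) * (u ⬝ᵥ (C *ᵥ u)))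

theorem finite_range_of_dependsOn_actions {β : Type*} [Nonempty β] {n : ℕ}
    {H : (ℕ → Finset (Fin d)) → β} (hH : DependsOn H (Set.Icc 1 n))
    (A : ℕ → Ω → Finset (Fin d)) : (Set.range fun ω => H fun s => A s ω).Finite := by
  obtain ⟨g, rfl⟩ := dependsOn_iff_exists_comp.1 hH
  exact (Set.finite_range g).subset (Set.range_subset_iff.2 fun ω => Set.mem_range_self _)

variable [mΩ : MeasurableSpace Ω] {P : Measure Ω} {ℱ : Filtration ℕ mΩ}
  {X : ℕ → Ω → Fin d → ℝ} {μ : Fin d → ℝ} {C : Matrix (Fin d) (Fin d) ℝ}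
  {A : ℕ → Ω → Finset (Fin d)}

theorem IsRewardProcess.isSubgaussianProcess (hX : IsRewardProcess P ℱ X μ C) :
    IsSubgaussianProcess P ℱ X μ C :=
  ⟨hX.adapted, hX.indep, hX.posSemidef, hX.exp_integrable, hX.subgaussian⟩

theorem measurable_of_dependsOn_actions {β : Type*} [MeasurableSpace β] [Nonempty β] {n : ℕ}
    {H : (ℕ → Finset (Fin d)) → β}
    (hA : ∀ t B, MeasurableSet[ℱ t] {ω | A (t + 1) ω = B})
    (hH : DependsOn H (Set.Icc 1 (n + 1))) : Measurable[ℱ n] fun ω => H fun s => A s ω := by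
  obtain ⟨g, rfl⟩ := dependsOn_iff_exists_comp.1 hH
  let _ : MeasurableSpace (Finset (Fin d)) := ⊤
  have : DiscreteMeasurableSpace (Finset (Fin d)) := ⟨fun _ => trivial⟩
  refine (Measurable.of_discrete (f := g)).comp (@measurable_pi_lambda _ _ _ (ℱ n) _ _ ?_)
  rintro ⟨s, hs1, hsn⟩
  obtain ⟨s, rfl⟩ := Nat.exists_eq_add_of_le' hs1
  exact @measurable_to_countable' _ _ _ _ (ℱ n) _ fun B => ℱ.mono (by omega) _ (hA s B)

theorem measurable_comp_action {β : Type*} [MeasurableSpace β] [Nonempty β]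
    (hA : ∀ t B, MeasurableSet[ℱ t] {ω | A (t + 1) ω = B}) (F : Finset (Fin d) → β) (t : ℕ) :
    Measurable[ℱ t] fun ω => F (A (t + 1) ω) :=
  measurable_of_dependsOn_actions (H := fun a => F (a (t + 1))) hA
    fun _ _ h => congrArg F (h _ ⟨by omega, le_rfl⟩)

theorem covSum_posSemidef (hC : C.PosSemidef) (a : ℕ → Finset (Fin d)) (t : ℕ) :
    (covSum C a t).PosSemidef := by
  refine Matrix.posSemidef_sum _ fun s _ => ?_
  simpa [proj] using hC.mul_mul_conjTranspose_same (proj (a s))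

theorem dotProduct_proj_mulVec (B : Finset (Fin d)) (u v : Fin d → ℝ) :
    u ⬝ᵥ (proj B *ᵥ v) = (proj B *ᵥ u) ⬝ᵥ v := by
  rw [Matrix.dotProduct_mulVec, ← Matrix.mulVec_transpose, proj, Matrix.diagonal_transpose]

theorem dotProduct_noiseSum_sub_covSum_succ (u : Fin d → ℝ) (a : ℕ → Finset (Fin d))
    (x : ℕ → Fin d → ℝ) {t : ℕ} (ht : 1 ≤ t) :
    u ⬝ᵥ noiseSum μ a x (t + 1) - 1 / 2 * (u ⬝ᵥ (covSum C a (t + 1) *ᵥ u)) =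
      u ⬝ᵥ noiseSum μ a x t - 1 / 2 * (u ⬝ᵥ (covSum C a t *ᵥ u)) +
        ((proj (a t) *ᵥ u) ⬝ᵥ (x t - μ) -
          1 / 2 * ((proj (a t) *ᵥ u) ⬝ᵥ (C *ᵥ (proj (a t) *ᵥ u)))) := by
  simp only [noiseSum, covSum, Finset.sum_Ico_succ_top ht, dotProduct_add, Matrix.add_mulVec,
    ← Matrix.mulVec_mulVec, dotProduct_proj_mulVec]
  ring

theorem measurable_noiseSum (hX : ∀ t, Measurable[ℱ (t + 1)] (X (t + 1)))
    (hA : ∀ t B, MeasurableSet[ℱ t] {ω | A (t + 1) ω = B}) (n : ℕ) :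
    Measurable[ℱ n] fun ω => noiseSum μ (fun s => A s ω) (fun s => X s ω) (n + 1) := by
  refine Finset.measurable_fun_sum _ fun s hs => ?_
  obtain ⟨hs1, hsn⟩ := Finset.mem_Ico.1 hs
  obtain ⟨s, rfl⟩ := Nat.exists_eq_add_of_le' hs1
  have hXs : Measurable[ℱ n] (X (s + 1)) := (hX s).mono (ℱ.mono (by omega)) le_rfl
  have hAs (i j : Fin d) : Measurable[ℱ n] fun ω => proj (A (s + 1) ω) i j :=
    (measurable_comp_action hA (fun B => proj B i j) s).mono (ℱ.mono (by omega)) le_rfl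
  refine @measurable_pi_lambda _ _ _ (ℱ n) _ _ fun i => ?_
  simp only [Matrix.mulVec, dotProduct]
  fun_prop

theorem dependsOn_covSum (n : ℕ) :
    DependsOn (fun a => covSum C a (n + 1)) (Set.Icc 1 n) := fun a b h => by
  refine Finset.sum_congr rfl fun s hs => ?_
  obtain ⟨hs1, hsn⟩ := Finset.mem_Ico.1 hs
  rw [h s ⟨hs1, by omega⟩]

namespace IsSubgaussianProcess

theorem lintegral_exp_sub_le_one (hX : IsSubgaussianProcess P ℱ X μ C) {t : ℕ} (ht : 1 ≤ t)
    (v : Fin d → ℝ) :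
    ∫⁻ ω, ENNReal.ofReal (Real.exp (v ⬝ᵥ (X t ω - μ) - 1 / 2 * (v ⬝ᵥ (C *ᵥ v)))) ∂P ≤ 1 := by
  simp_rw [Real.exp_sub, div_eq_mul_inv, ENNReal.ofReal_mul (Real.exp_nonneg _)]
  rw [lintegral_mul_const' _ _ ENNReal.ofReal_ne_top,
    ← ofReal_integral_eq_lintegral_ofReal (hX.exp_integrable t ht v)
      (.of_forall fun ω => Real.exp_nonneg _),
    ← ENNReal.ofReal_mul (integral_nonneg fun ω => Real.exp_nonneg _), ENNReal.ofReal_le_one]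
  exact mul_inv_le_one_of_le₀ (by simpa using hX.subgaussian t ht v) (Real.exp_nonneg _)

theorem lintegral_exp_noiseSum_le_one [IsProbabilityMeasure P]
    (hX : IsSubgaussianProcess P ℱ X μ C)
    (hA : ∀ t B, MeasurableSet[ℱ t] {ω | A (t + 1) ω = B}) (u : Fin d → ℝ) (n : ℕ) :
    ∫⁻ ω, ENNReal.ofReal (Real.exp
      (u ⬝ᵥ noiseSum μ (fun s => A s ω) (fun s => X s ω) (n + 1) -
        1 / 2 * (u ⬝ᵥ (covSum C (fun s => A s ω) (n + 1) *ᵥ u)))) ∂P ≤ 1 := by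
  induction n with
  | zero => simp [noiseSum, covSum]
  | succ n ih =>
    have hS := measurable_noiseSum (μ := μ) hX.adapted hA n
    have hV : Measurable[ℱ n] fun ω => u ⬝ᵥ (covSum C (fun s => A s ω) (n + 1) *ᵥ u) :=
      measurable_of_dependsOn_actions (H := fun a => u ⬝ᵥ (covSum C a (n + 1) *ᵥ u)) hA
        fun a b h => by
          simp only [dependsOn_covSum n (fun s hs => h s ⟨hs.1, hs.2.trans (Nat.le_succ n)⟩)]
    have hU : Measurable[ℱ n] fun ω => proj (A (n + 1) ω) *ᵥ u :=
      measurable_comp_action hA (fun B => proj B *ᵥ u) n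
    simp_rw [dotProduct_noiseSum_sub_covSum_succ u _ _ (Nat.le_add_left 1 n), Real.exp_add,
      ENNReal.ofReal_mul (Real.exp_nonneg _)]
    refine (lintegral_mul_comp_le_of_indep (ℱ.le n) ((hX.adapted n).mono (ℱ.le _) le_rfl)
      (hX.indep n) ?_ hU (g := fun z => ENNReal.ofReal (Real.exp (z.1 ⬝ᵥ (z.2 - μ) -
        1 / 2 * (z.1 ⬝ᵥ (C *ᵥ z.1))))) ?_ (hX.lintegral_exp_sub_le_one (by omega))).trans ih
    · simp only [dotProduct] at hV ⊢
      fun_prop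
    · simp only [Matrix.mulVec, dotProduct]
      fun_prop

theorem isCanonicalPair [IsProbabilityMeasure P] (hX : IsSubgaussianProcess P ℱ X μ C)
    (hA : ∀ t B, MeasurableSet[ℱ t] {ω | A (t + 1) ω = B}) (n : ℕ) :
    IsCanonicalPair P (fun ω => noiseSum μ (fun s => A s ω) (fun s => X s ω) (n + 1))
      (fun ω => covSum C (fun s => A s ω) (n + 1)) where
  measurable_left i := (measurable_pi_apply i).comp
    ((measurable_noiseSum hX.adapted hA n).mono (ℱ.le n) le_rfl)
  measurable_right i j := (measurable_of_dependsOn_actions (n := n)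
    (H := fun a => covSum C a (n + 1) i j) hA fun a b h => by
      simp only [dependsOn_covSum n (fun s hs => h s ⟨hs.1, hs.2.trans (Nat.le_succ n)⟩)]).mono
    (ℱ.le n) le_rfl
  posSemidef _ := covSum_posSemidef hX.posSemidef _ _
  lintegral_exp_le_one u := hX.lintegral_exp_noiseSum_le_one hA u n

end IsSubgaussianProcess

end Noise

section Width

variable {Γ C : Matrix (Fin d) (Fin d) ℝ} {a : ℕ → Finset (Fin d)} {t : ℕ}

/-- The number of stages before stage `t` at which the arms `i` and `j` are pulled together. -/
def jointPulls (a : ℕ → Finset (Fin d)) (t : ℕ) (i j : Fin d) : ℕ :=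
  ((Finset.Ico 1 t).filter (fun s => i ∈ a s ∧ j ∈ a s)).card

/-- The vector `D_t⁻¹ A` of the weights with which the accumulated noises enter the estimate of the
mean reward of `A`. -/
def avgVec (a : ℕ → Finset (Fin d)) (t : ℕ) (A : Finset (Fin d)) : Fin d → ℝ :=
  fun i => vec A i / pulls a t i

/-- The regularized covariance matrix `lam Σ_Γ D_t + ∑_{s < t} Γ_{A_s}` of the exploration term. -/
def regCovSum (Γ : Matrix (Fin d) (Fin d) ℝ) (lam : ℝ) (a : ℕ → Finset (Fin d)) (t : ℕ) :
    Matrix (Fin d) (Fin d) ℝ :=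
  lam • (Matrix.diagonal (fun i => Γ i i) * design a t) + covSum Γ a t

theorem jointPulls_self (a : ℕ → Finset (Fin d)) (t : ℕ) (i : Fin d) :
    jointPulls a t i i = pulls a t i := by
  simp only [jointPulls, pulls, and_self]

theorem jointPulls_le_left (a : ℕ → Finset (Fin d)) (t : ℕ) (i j : Fin d) :
    jointPulls a t i j ≤ pulls a t i :=
  Finset.card_le_card (Finset.monotone_filter_right _ fun _ _ h => h.1)

theorem jointPulls_le_right (a : ℕ → Finset (Fin d)) (t : ℕ) (i j : Fin d) :
    jointPulls a t i j ≤ pulls a t j :=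
  Finset.card_le_card (Finset.monotone_filter_right _ fun _ _ h => h.2)

theorem covSum_apply (C : Matrix (Fin d) (Fin d) ℝ) (a : ℕ → Finset (Fin d)) (t : ℕ)
    (i j : Fin d) : covSum C a t i j = jointPulls a t i j * C i j := by
  have hterm (s : ℕ) :
      (proj (a s) * C * proj (a s)) i j = if i ∈ a s ∧ j ∈ a s then C i j else 0 := by
    rw [proj, Matrix.mul_diagonal, Matrix.diagonal_mul]
    by_cases hi : i ∈ a s <;> by_cases hj : j ∈ a s <;> simp [vec, hi, hj]
  rw [covSum, Matrix.sum_apply]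
  simp only [hterm]
  rw [← Finset.sum_filter, Finset.sum_const, jointPulls, nsmul_eq_mul]

theorem design_eq_diagonal (a : ℕ → Finset (Fin d)) (t : ℕ) :
    design a t = Matrix.diagonal fun i => (pulls a t i : ℝ) := by
  have h (s : ℕ) : proj (a s) = Matrix.diagonalAddMonoidHom (Fin d) ℝ (vec (a s)) := rfl
  simp only [design, h]
  rw [← map_sum]
  refine congrArg Matrix.diagonal (funext fun i => ?_)
  simp [vec, pulls]

theorem noiseSum_apply (μ : Fin d → ℝ) (a : ℕ → Finset (Fin d)) (x : ℕ → Fin d → ℝ) (t : ℕ)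
    (i : Fin d) :
    noiseSum μ a x t i = ∑ s ∈ (Finset.Ico 1 t).filter (fun s => i ∈ a s), (x s i - μ i) := by
  rw [noiseSum, Finset.sum_apply, Finset.sum_filter]
  simp [proj, vec, Matrix.mulVec_diagonal]

theorem proj_mulVec_avgVec (a : ℕ → Finset (Fin d)) (t : ℕ) (A : Finset (Fin d)) :
    proj A *ᵥ avgVec a t A = avgVec a t A := by
  funext i
  by_cases hi : i ∈ A <;> simp [proj, avgVec, vec, Matrix.mulVec_diagonal, hi]

theorem avgVec_nonneg (a : ℕ → Finset (Fin d)) (t : ℕ) (A : Finset (Fin d)) (i : Fin d) :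
    0 ≤ avgVec a t A i := by
  unfold avgVec vec
  positivity

theorem avgVec_dotProduct (a : ℕ → Finset (Fin d)) (t : ℕ) (A : Finset (Fin d)) (v : Fin d → ℝ) :
    avgVec a t A ⬝ᵥ v = ∑ i ∈ A, v i / pulls a t i := by
  simp [dotProduct, avgVec, vec, ite_div, inv_mul_eq_div]

theorem sum_muHat_sub_meanReward (μ : Fin d → ℝ) (x : ℕ → Fin d → ℝ) (hN : ∀ i, pulls a t i ≠ 0)
    (A : Finset (Fin d)) :
    ∑ i ∈ A, muHat a x t i - meanReward μ A = avgVec a t A ⬝ᵥ noiseSum μ a x t := by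
  rw [avgVec_dotProduct, meanReward, ← Finset.sum_sub_distrib]
  refine Finset.sum_congr rfl fun i _ => ?_
  have : (pulls a t i : ℝ) ≠ 0 := by exact_mod_cast hN i
  rw [noiseSum_apply, Finset.sum_sub_distrib, Finset.sum_const, nsmul_eq_mul, muHat]
  change _ = (_ - (pulls a t i : ℝ) * μ i) / _
  field_simp

theorem design_inv_mulVec_vec (hN : ∀ i, pulls a t i ≠ 0) (A : Finset (Fin d)) :
    (design a t)⁻¹ *ᵥ vec A = avgVec a t A := by
  have hinv : (design a t)⁻¹ = Matrix.diagonal fun i => (pulls a t i : ℝ)⁻¹ := by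
    refine Matrix.inv_eq_right_inv ?_
    rw [design_eq_diagonal, Matrix.diagonal_mul_diagonal, ← Matrix.diagonal_one]
    exact congrArg Matrix.diagonal
      (funext fun i => mul_inv_cancel₀ (by exact_mod_cast hN i))
  funext i
  rw [hinv, Matrix.mulVec_diagonal, avgVec, inv_mul_eq_div]

theorem bonus_eq (Γ : Matrix (Fin d) (Fin d) ℝ) (lam : ℝ) (hN : ∀ i, pulls a t i ≠ 0)
    (A : Finset (Fin d)) :
    bonus m Γ lam a t A = √(2 * explore m lam t) *
      √(avgVec a t A ⬝ᵥ (regCovSum Γ lam a t *ᵥ avgVec a t A)) := by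
  have hsymm : (design a t)⁻¹ᵀ = (design a t)⁻¹ := by
    rw [Matrix.transpose_nonsing_inv, design_eq_diagonal, Matrix.diagonal_transpose]
  rw [bonus, ← Matrix.mulVec_mulVec, ← Matrix.mulVec_mulVec, design_inv_mulVec_vec hN,
    Matrix.dotProduct_mulVec, ← Matrix.mulVec_transpose, hsymm, design_inv_mulVec_vec hN]
  rfl

theorem dotProduct_covSum_mulVec (C : Matrix (Fin d) (Fin d) ℝ) (a : ℕ → Finset (Fin d)) (t : ℕ)
    (v : Fin d → ℝ) :
    v ⬝ᵥ (covSum C a t *ᵥ v) =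
      ∑ s ∈ Finset.Ico 1 t, (proj (a s) *ᵥ v) ⬝ᵥ (C *ᵥ (proj (a s) *ᵥ v)) := by
  simp only [covSum, Matrix.sum_mulVec, dotProduct_sum, ← Matrix.mulVec_mulVec,
    dotProduct_proj_mulVec]

theorem LePos.le_of_nonneg (h : LePos C Γ) {v : Fin d → ℝ} (hv : ∀ i, 0 ≤ v i) :
    v ⬝ᵥ (C *ᵥ v) ≤ v ⬝ᵥ (Γ *ᵥ v) := by
  have hlim (M : Matrix (Fin d) (Fin d) ℝ) : Filter.Tendsto
      (fun e : ℝ => (fun i => v i + e) ⬝ᵥ (M *ᵥ fun i => v i + e)) (nhdsWithin 0 (Set.Ioi 0))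
      (nhds (v ⬝ᵥ (M *ᵥ v))) := by
    have hcont : Continuous fun e : ℝ => (fun i => v i + e) ⬝ᵥ (M *ᵥ fun i => v i + e) := by
      unfold Matrix.mulVec dotProduct
      fun_prop
    simpa using (hcont.tendsto 0).mono_left nhdsWithin_le_nhds
  refine le_of_tendsto_of_tendsto (hlim C) (hlim Γ) ?_
  filter_upwards [self_mem_nhdsWithin] with e he
  exact h _ fun i => add_pos_of_nonneg_of_pos (hv i) he

theorem LePos.diag_le (h : LePos C Γ) (i : Fin d) : C i i ≤ Γ i i := by
  have hv : (0 : Fin d → ℝ) ≤ Pi.single i 1 := Pi.single_nonneg.2 zero_le_one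
  simpa using h.le_of_nonneg hv

theorem LePos.covSum_le (h : LePos C Γ) (a : ℕ → Finset (Fin d)) (t : ℕ) {v : Fin d → ℝ}
    (hv : ∀ i, 0 ≤ v i) : v ⬝ᵥ (covSum C a t *ᵥ v) ≤ v ⬝ᵥ (covSum Γ a t *ᵥ v) := by
  rw [dotProduct_covSum_mulVec, dotProduct_covSum_mulVec]
  refine Finset.sum_le_sum fun s _ => h.le_of_nonneg fun i => ?_
  rw [proj, Matrix.mulVec_diagonal, vec]
  have := hv i
  positivity

theorem dotProduct_regCovSum_mulVec (Γ : Matrix (Fin d) (Fin d) ℝ) (lam : ℝ)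
    (a : ℕ → Finset (Fin d)) (t : ℕ) (v : Fin d → ℝ) :
    v ⬝ᵥ (regCovSum Γ lam a t *ᵥ v) =
      lam * ∑ i, Γ i i * pulls a t i * v i ^ 2 + v ⬝ᵥ (covSum Γ a t *ᵥ v) := by
  rw [regCovSum, design_eq_diagonal, Matrix.diagonal_mul_diagonal, Matrix.add_mulVec,
    dotProduct_add, Matrix.smul_mulVec, dotProduct_smul, smul_eq_mul]
  congr 2
  exact Finset.sum_congr rfl fun i _ => by rw [Matrix.mulVec_diagonal]; ring

end Width

section Correlation

variable {Γ : Matrix (Fin d) (Fin d) ℝ} {a : ℕ → Finset (Fin d)} {t T : ℕ}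

theorem sq_apply_le_of_posSemidef (hΓ : Γ.PosSemidef) (i j : Fin d) :
    Γ i j ^ 2 ≤ Γ i i * Γ j j := by
  have hsymm : Γ j i = Γ i j := by simpa using hΓ.isHermitian.apply i j
  have hquad (x : ℝ) : 0 ≤ Γ i i * (x * x) + 2 * Γ i j * x + Γ j j := by
    have h := hΓ.dotProduct_mulVec_nonneg (Pi.single i x + Pi.single j 1)
    simp only [star_trivial, Matrix.mulVec_add, dotProduct_add, add_dotProduct,
      single_dotProduct, Matrix.mulVec_single, Matrix.col_apply, Pi.smul_apply,
      MulOpposite.smul_eq_mul_unop, MulOpposite.unop_op, hsymm] at h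
    linarith
  have := discrim_le_zero hquad
  unfold discrim at this
  linarith

theorem abs_apply_le_sqrt (hΓ : Γ.PosSemidef) (i j : Fin d) : |Γ i j| ≤ √(Γ i i * Γ j j) :=
  Real.abs_le_sqrt (sq_apply_le_of_posSemidef hΓ i j)

theorem corr_le_one (hΓ : Γ.PosSemidef) (A : Finset (Fin d)) : corr Γ A ≤ 1 :=
  Real.iSup_le (fun _ => div_le_one_of_le₀ ((le_abs_self _).trans (abs_apply_le_sqrt hΓ _ _))
    (Real.sqrt_nonneg _)) zero_le_one

theorem maxCorr_le_one (hΓ : Γ.PosSemidef) (a : ℕ → Finset (Fin d)) (T : ℕ) :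
    maxCorr Γ a T ≤ 1 :=
  Real.iSup_le (fun t => corr_le_one hΓ (a t)) zero_le_one

theorem maxCorr_nonneg (hΓ0 : ∀ i j, 0 ≤ Γ i j) (a : ℕ → Finset (Fin d)) (T : ℕ) :
    0 ≤ maxCorr Γ a T :=
  Real.iSup_nonneg fun _ => Real.iSup_nonneg fun _ => div_nonneg (hΓ0 _ _) (Real.sqrt_nonneg _)

theorem apply_le_maxCorr_mul_sqrt (hΓ : Γ.PosSemidef) (ht : t ∈ Finset.Icc 1 T) {i j : Fin d}
    (hi : i ∈ a t) (hj : j ∈ a t) (hij : i ≠ j) :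
    Γ i j ≤ maxCorr Γ a T * √(Γ i i * Γ j j) := by
  have hcorr : Γ i j / √(Γ i i * Γ j j) ≤ corr Γ (a t) :=
    le_ciSup (f := fun p : (a t).offDiag =>
      Γ p.1.1 p.1.2 / √(Γ p.1.1 p.1.1 * Γ p.1.2 p.1.2)) (Set.finite_range _).bddAbove
      ⟨(i, j), Finset.mem_offDiag.2 ⟨hi, hj, hij⟩⟩
  have hmax : corr Γ (a t) ≤ maxCorr Γ a T :=
    le_ciSup (f := fun t : Finset.Icc 1 T => corr Γ (a t)) (Set.finite_range _).bddAbove ⟨t, ht⟩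
  rcases (Real.sqrt_nonneg (Γ i i * Γ j j)).eq_or_lt with h0 | h0
  · have h := (le_abs_self _).trans (abs_apply_le_sqrt hΓ i j)
    rw [← h0] at h ⊢
    simpa using h
  · rw [← div_le_iff₀ h0]
    exact hcorr.trans hmax

theorem covSum_div_le (hΓ : Γ.PosSemidef) (hΓ0 : ∀ i j, 0 ≤ Γ i j) (ht : t ∈ Finset.Icc 1 T)
    (hN : ∀ i, pulls a t i ≠ 0) {i j : Fin d} (hi : i ∈ a t) (hj : j ∈ a t) (hij : i ≠ j) :
    covSum Γ a t i j / (pulls a t i * pulls a t j) ≤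
      maxCorr Γ a T * (√(Γ i i / pulls a t i) * √(Γ j j / pulls a t j)) := by
  have hNi : (0 : ℝ) < pulls a t i := by exact_mod_cast Nat.pos_of_ne_zero (hN i)
  have hNj : (0 : ℝ) < pulls a t j := by exact_mod_cast Nat.pos_of_ne_zero (hN j)
  have hJi : (jointPulls a t i j : ℝ) ≤ pulls a t i := by
    exact_mod_cast jointPulls_le_left a t i j
  have hJj : (jointPulls a t i j : ℝ) ≤ pulls a t j := by
    exact_mod_cast jointPulls_le_right a t i j
  set Ni := (pulls a t i : ℝ)
  set Nj := (pulls a t j : ℝ)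
  have hJ : (jointPulls a t i j : ℝ) ≤ √(Ni * Nj) :=
    Real.le_sqrt_of_sq_le (by rw [sq]; gcongr)
  calc covSum Γ a t i j / (Ni * Nj)
      ≤ √(Ni * Nj) * (maxCorr Γ a T * √(Γ i i * Γ j j)) / (Ni * Nj) := by
        rw [covSum_apply]
        have := hΓ0 i j
        gcongr
        exact apply_le_maxCorr_mul_sqrt hΓ ht hi hj hij
    _ = maxCorr Γ a T * (√(Γ i i * Γ j j) / √(Ni * Nj)) := by
        rw [mul_div_right_comm, Real.sqrt_div_self']
        ring
    _ = maxCorr Γ a T * (√(Γ i i / Ni) * √(Γ j j / Nj)) := by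
        rw [← Real.sqrt_mul (div_nonneg (hΓ0 i i) hNi.le), div_mul_div_comm,
          Real.sqrt_div (mul_nonneg (hΓ0 i i) (hΓ0 j j))]

theorem avgVec_covSum_le (hΓ : Γ.PosSemidef) (hΓ0 : ∀ i j, 0 ≤ Γ i j) (ht : t ∈ Finset.Icc 1 T)
    (hN : ∀ i, pulls a t i ≠ 0) :
    avgVec a t (a t) ⬝ᵥ (covSum Γ a t *ᵥ avgVec a t (a t)) ≤
      (1 - maxCorr Γ a T) * ∑ i ∈ a t, Γ i i / pulls a t i +
        maxCorr Γ a T * (∑ i ∈ a t, √(Γ i i / pulls a t i)) ^ 2 := by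
  set γ := maxCorr Γ a T
  set y : Fin d → ℝ := fun i => √(Γ i i / pulls a t i)
  have hterm : ∀ i ∈ a t, ∀ j ∈ a t, covSum Γ a t i j / (pulls a t i * pulls a t j) ≤
      (if i = j then (1 - γ) * (Γ i i / pulls a t i) else 0) + γ * (y i * y j) := by
    intro i hi j hj
    split_ifs with hij
    · subst hij
      have : (pulls a t i : ℝ) ≠ 0 := by exact_mod_cast hN i
      rw [covSum_apply, jointPulls_self, Real.mul_self_sqrt
        (div_nonneg (hΓ0 i i) (Nat.cast_nonneg _)), mul_div_mul_left _ _ this]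
      linarith
    · rw [zero_add]
      exact covSum_div_le hΓ hΓ0 ht hN hi hj hij
  calc avgVec a t (a t) ⬝ᵥ (covSum Γ a t *ᵥ avgVec a t (a t))
      = ∑ i ∈ a t, ∑ j ∈ a t, covSum Γ a t i j / (pulls a t i * pulls a t j) := by
        rw [avgVec_dotProduct]
        refine Finset.sum_congr rfl fun i _ => ?_
        rw [Matrix.mulVec, dotProduct_comm, avgVec_dotProduct, Finset.sum_div]
        exact Finset.sum_congr rfl fun j _ => by rw [div_div, mul_comm (pulls a t i : ℝ)]
    _ ≤ ∑ i ∈ a t, ∑ j ∈ a t,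
        ((if i = j then (1 - γ) * (Γ i i / pulls a t i) else 0) + γ * (y i * y j)) :=
        Finset.sum_le_sum fun i hi => Finset.sum_le_sum fun j hj => hterm i hi j hj
    _ = (1 - γ) * ∑ i ∈ a t, Γ i i / pulls a t i + γ * (∑ i ∈ a t, y i) ^ 2 := by
        rw [sq, Finset.sum_mul_sum]
        simp only [Finset.sum_add_distrib, Finset.mul_sum]
        congr 1
        exact Finset.sum_congr rfl fun i hi => by rw [Finset.sum_ite_eq, if_pos hi]

theorem avgVec_regCovSum_le (hΓ : Γ.PosSemidef) (hΓ0 : ∀ i j, 0 ≤ Γ i j) (lam : ℝ)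
    (ht : t ∈ Finset.Icc 1 T) (hN : ∀ i, pulls a t i ≠ 0) :
    avgVec a t (a t) ⬝ᵥ (regCovSum Γ lam a t *ᵥ avgVec a t (a t)) ≤
      (lam + 1 - maxCorr Γ a T) * ∑ i ∈ a t, Γ i i / pulls a t i +
        maxCorr Γ a T * (∑ i ∈ a t, √(Γ i i / pulls a t i)) ^ 2 := by
  have hdiag : ∑ i, Γ i i * pulls a t i * avgVec a t (a t) i ^ 2 =
      ∑ i ∈ a t, Γ i i / pulls a t i := by
    rw [← avgVec_dotProduct]
    refine Finset.sum_congr rfl fun i _ => ?_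
    have : (pulls a t i : ℝ) ≠ 0 := by exact_mod_cast hN i
    by_cases hi : i ∈ a t <;> simp [avgVec, vec, hi]
    field_simp
  rw [dotProduct_regCovSum_mulVec, hdiag]
  linarith [avgVec_covSum_le hΓ hΓ0 ht hN]

end Correlation

section Confidence

theorem pulls_lt (a : ℕ → Finset (Fin d)) (n : ℕ) (i : Fin d) : pulls a (n + 1) i < n + 1 := by
  have h := Finset.card_filter_le (Finset.Ico 1 (n + 1)) (fun s => i ∈ a s)
  rw [Nat.card_Ico] at h
  exact Nat.lt_succ_of_le h

theorem one_le_log_natCast {t : ℕ} (ht : 3 ≤ t) : 1 ≤ Real.log t := by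
  have h3 : (3 : ℝ) ≤ t := by exact_mod_cast ht
  rw [Real.le_log_iff_exp_le (by linarith)]
  linarith [Real.exp_one_lt_d9]

theorem explore_nonneg {lam : ℝ} (hlam : 0 < lam) {t : ℕ} (ht : 3 ≤ t) :
    0 ≤ explore m lam t := by
  have hl := one_le_log_natCast ht
  have hll := Real.log_nonneg hl
  have hreg : 0 ≤ Real.log (1 + Real.exp 1 / lam) :=
    Real.log_nonneg (le_add_of_nonneg_right (by positivity))
  unfold explore
  positivity

theorem exp_neg_explore {lam : ℝ} (hlam : 0 < lam) {t : ℕ} (ht : 2 ≤ t) :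
    Real.exp (-explore m lam t) =
      (t * Real.log t ^ (m + 2) * √(1 + Real.exp 1 / lam) ^ m)⁻¹ := by
  have hl : 0 < Real.log t := Real.log_pos (by exact_mod_cast ht)
  have hc : 0 < 1 + Real.exp 1 / lam := by positivity
  have hpow : Real.exp ((m + 2) * Real.log (Real.log t)) = Real.log t ^ (m + 2) := by
    rw [← Real.exp_log (pow_pos hl (m + 2)), Real.log_pow]
    push_cast
    rfl
  have hsqrt : Real.exp (m / 2 * Real.log (1 + Real.exp 1 / lam)) =
      √(1 + Real.exp 1 / lam) ^ m := by
    rw [← Real.exp_log (pow_pos (Real.sqrt_pos.2 hc) m), Real.log_pow, Real.log_sqrt hc.le]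
    ring_nf
  rw [Real.exp_neg, explore, Real.exp_add, Real.exp_add, Real.exp_log (by positivity), hpow, hsqrt]

theorem exp_le_exp_one_mul_sq {x : ℝ} (h1 : 1 ≤ x) (h2 : x ≤ 2) :
    Real.exp x ≤ Real.exp 1 * x ^ 2 := by
  have h := (abs_le.1 (Real.abs_exp_sub_one_sub_id_le (x := x - 1)
    (abs_le.2 ⟨by linarith, by linarith⟩))).2
  rw [show x = 1 + (x - 1) by ring, Real.exp_add]
  exact mul_le_mul_of_nonneg_left (by nlinarith) (Real.exp_nonneg 1)

-- A grid of the integer size `⌊L⌋` is coarser than one of ratio `e`, but has fewer points.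
theorem floor_mul_sqrt_le {lam : ℝ} (hlam : 0 < lam) {L : ℝ} (hL : 1 ≤ L) :
    ⌊L⌋₊ * √(1 + Real.exp (L / ⌊L⌋₊) / lam) ≤ L * √(1 + Real.exp 1 / lam) := by
  have hK : (1 : ℝ) ≤ ⌊L⌋₊ := by exact_mod_cast Nat.le_floor (by simpa using hL)
  have hKL : (⌊L⌋₊ : ℝ) ≤ L := Nat.floor_le (by linarith)
  have hLK : L < ⌊L⌋₊ + 1 := Nat.lt_floor_add_one L
  set K : ℝ := (⌊L⌋₊ : ℝ)
  have hexp : K ^ 2 * Real.exp (L / K) ≤ L ^ 2 * Real.exp 1 := by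
    calc K ^ 2 * Real.exp (L / K) ≤ K ^ 2 * (Real.exp 1 * (L / K) ^ 2) := by
          gcongr
          refine exp_le_exp_one_mul_sq ?_ ?_
          · rw [one_le_div₀ (by linarith)]
            exact hKL
          · rw [div_le_iff₀ (by linarith)]
            linarith
      _ = L ^ 2 * Real.exp 1 := by field_simp
  rw [← Real.sqrt_sq (zero_le_one.trans hK), ← Real.sqrt_mul (by positivity),
    ← Real.sqrt_sq (zero_le_one.trans hL), ← Real.sqrt_mul (by positivity)]
  simp only [Real.sqrt_sq (zero_le_one.trans hK), Real.sqrt_sq (zero_le_one.trans hL)]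
  refine Real.sqrt_le_sqrt ?_
  calc K ^ 2 * (1 + Real.exp (L / K) / lam) = K ^ 2 + K ^ 2 * Real.exp (L / K) / lam := by ring
    _ ≤ L ^ 2 + L ^ 2 * Real.exp 1 / lam := by gcongr
    _ = L ^ 2 * (1 + Real.exp 1 / lam) := by ring

variable [mΩ : MeasurableSpace Ω] {P : Measure Ω} [IsProbabilityMeasure P] {ℱ : Filtration ℕ mΩ}
  {X : ℕ → Ω → Fin d → ℝ} {μ : Fin d → ℝ} {C Γ : Matrix (Fin d) (Fin d) ℝ}
  {A : ℕ → Ω → Finset (Fin d)}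

theorem LePos.avgVec_covSum_add_diagonal_le (hCΓ : LePos C Γ) {lam : ℝ} {a : ℕ → Finset (Fin d)}
    {t : ℕ} {B : Finset (Fin d)} {p : Fin d → ℝ}
    (hp : ∀ i ∈ B, p i ≤ lam * (Γ i i * pulls a t i)) :
    avgVec a t B ⬝ᵥ ((covSum C a t + Matrix.diagonal p) *ᵥ avgVec a t B) ≤
      avgVec a t B ⬝ᵥ (regCovSum Γ lam a t *ᵥ avgVec a t B) := by
  rw [Matrix.add_mulVec, dotProduct_add, dotProduct_regCovSum_mulVec, add_comm, Finset.mul_sum]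
  refine add_le_add (Finset.sum_le_sum fun i _ => ?_) (hCΓ.covSum_le a t (avgVec_nonneg a t B))
  rw [Matrix.mulVec_diagonal]
  by_cases hi : i ∈ B
  · calc avgVec a t B i * (p i * avgVec a t B i) = p i * avgVec a t B i ^ 2 := by ring
      _ ≤ lam * (Γ i i * pulls a t i) * avgVec a t B i ^ 2 := by
          gcongr
          exact hp i hi
      _ = _ := by ring
  · simp [avgVec, vec, hi]

theorem IsSubgaussianProcess.measure_cell_le (hX : IsSubgaussianProcess P ℱ X μ C)
    (hA : ∀ t B, MeasurableSet[ℱ t] {ω | A (t + 1) ω = B}) (hCΓ : LePos C Γ)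
    {lam : ℝ} (hlam : 0 < lam) (B : Finset (Fin d)) {f : ℝ} (hf : 0 ≤ f)
    {r : ℝ} (hr : 0 < r) (k : Fin d → ℕ) (n : ℕ) :
    P {ω | (∀ i ∈ B, r ^ k i ≤ pulls (fun s => A s ω) (n + 1) i ∧
        (pulls (fun s => A s ω) (n + 1) i : ℝ) ≤ r ^ (k i + 1)) ∧
      2 * f * (avgVec (fun s => A s ω) (n + 1) B ⬝ᵥ
        (regCovSum Γ lam (fun s => A s ω) (n + 1) *ᵥ avgVec (fun s => A s ω) (n + 1) B)) <
      (avgVec (fun s => A s ω) (n + 1) B ⬝ᵥ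
        noiseSum μ (fun s => A s ω) (fun s => X s ω) (n + 1)) ^ 2} ≤
    ENNReal.ofReal (Real.exp (-f) * √(1 + r / lam) ^ B.card) := by
  have hC0 (i : Fin d) : 0 ≤ C i i := hX.posSemidef.diag_nonneg
  have hΓ0 (i : Fin d) : 0 ≤ Γ i i := (hC0 i).trans (hCΓ.diag_le i)
  refine (measure_mono ?_).trans ((hX.isCanonicalPair hA n).measure_supported_lt_sq_le B
    (p := fun i => lam * (Γ i i * r ^ k i)) (fun i => by have := hΓ0 i; positivity)
    (κ := r / lam) (by positivity) hf)
  rintro ω ⟨hcell, hdev⟩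
  refine ⟨fun i hi => ?_, _, proj_mulVec_avgVec _ _ B, lt_of_le_of_lt ?_ hdev⟩
  · calc covSum C (fun s => A s ω) (n + 1) i i
        = pulls (fun s => A s ω) (n + 1) i * C i i := by rw [covSum_apply, jointPulls_self]
      _ ≤ r ^ (k i + 1) * Γ i i :=
          mul_le_mul (hcell i hi).2 (hCΓ.diag_le i) (hC0 i) (by positivity)
      _ = r / lam * (lam * (Γ i i * r ^ k i)) := by
          field_simp
          ring
  · refine mul_le_mul_of_nonneg_left (hCΓ.avgVec_covSum_add_diagonal_le fun i hi => ?_)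
      (by positivity)
    gcongr
    · exact hΓ0 i
    · exact (hcell i hi).1

theorem exists_mem_piFinset_pow_near {r : ℝ} (hr : 1 < r) {K : ℕ} (B : Finset (Fin d))
    {N : Fin d → ℕ} (hN : ∀ i, N i ≠ 0) (hNK : ∀ i, (N i : ℝ) < r ^ K) :
    ∃ k ∈ Fintype.piFinset fun i => if i ∈ B then Finset.range K else {0},
      ∀ i ∈ B, r ^ k i ≤ N i ∧ (N i : ℝ) ≤ r ^ (k i + 1) := by
  have hnear (i : Fin d) : ∃ k : ℕ, r ^ k ≤ N i ∧ (N i : ℝ) < r ^ (k + 1) :=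
    exists_nat_pow_near (by exact_mod_cast Nat.pos_of_ne_zero (hN i)) hr
  choose k hle hlt using hnear
  have hkK (i : Fin d) : k i < K :=
    (pow_lt_pow_iff_right₀ hr).1 ((hle i).trans_lt (hNK i))
  refine ⟨fun i => if i ∈ B then k i else 0, Fintype.mem_piFinset.2 fun i => ?_, fun i hi => ?_⟩
  · by_cases hi : i ∈ B
    · simpa [hi] using hkK i
    · simp [hi]
  · simpa only [hi, if_true] using ⟨hle i, (hlt i).le⟩

theorem IsSubgaussianProcess.measure_width_lt_le (hX : IsSubgaussianProcess P ℱ X μ C)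
    (hA : ∀ t B, MeasurableSet[ℱ t] {ω | A (t + 1) ω = B}) (hCΓ : LePos C Γ)
    {lam : ℝ} (hlam : 0 < lam) (B : Finset (Fin d)) {f : ℝ} (hf : 0 ≤ f)
    {r : ℝ} (hr : 1 < r) {n K : ℕ} (hK : (n + 1 : ℕ) ≤ r ^ K) :
    P {ω | (∀ i, pulls (fun s => A s ω) (n + 1) i ≠ 0) ∧
      2 * f * (avgVec (fun s => A s ω) (n + 1) B ⬝ᵥ
        (regCovSum Γ lam (fun s => A s ω) (n + 1) *ᵥ avgVec (fun s => A s ω) (n + 1) B)) <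
      (avgVec (fun s => A s ω) (n + 1) B ⬝ᵥ
        noiseSum μ (fun s => A s ω) (fun s => X s ω) (n + 1)) ^ 2} ≤
    ENNReal.ofReal ((K * √(1 + r / lam)) ^ B.card * Real.exp (-f)) := by
  set F := Fintype.piFinset fun i : Fin d => if i ∈ B then Finset.range K else {0}
  have hcard : F.card = K ^ B.card := by
    rw [Fintype.card_piFinset, Finset.prod_congr rfl fun i _ => apply_ite Finset.card _ _ _]
    simp only [Finset.card_range, Finset.card_singleton, Finset.prod_ite_mem,
      Finset.univ_inter, Finset.prod_const]
  have hcells := (Finset.sum_le_sum fun k (_ : k ∈ F) =>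
    hX.measure_cell_le hA hCΓ hlam B hf (zero_lt_one.trans hr) k n).trans_eq
      (Finset.sum_const _)
  refine (measure_mono ?_).trans ((measure_biUnion_finset_le F _).trans (hcells.trans_eq ?_))
  · rintro ω ⟨hN, hdev⟩
    obtain ⟨k, hkF, hk⟩ := exists_mem_piFinset_pow_near hr B hN fun i =>
      (Nat.cast_lt.2 (pulls_lt (fun s => A s ω) n i)).trans_le hK
    exact Set.mem_biUnion (Finset.mem_coe.2 hkF) ⟨hk, hdev⟩
  · rw [hcard, nsmul_eq_mul, ← ENNReal.ofReal_natCast, ← ENNReal.ofReal_mul (Nat.cast_nonneg _)]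
    congr 1
    push_cast
    ring

theorem lt_sq_of_index_lt_meanReward {lam : ℝ} {a : ℕ → Finset (Fin d)} {x : ℕ → Fin d → ℝ}
    {t : ℕ} (hf : 0 ≤ explore m lam t) (hN : ∀ i, pulls a t i ≠ 0) {B : Finset (Fin d)}
    (h : index m Γ lam a x t B < meanReward μ B) :
    2 * explore m lam t * (avgVec a t B ⬝ᵥ (regCovSum Γ lam a t *ᵥ avgVec a t B)) <
      (avgVec a t B ⬝ᵥ noiseSum μ a x t) ^ 2 := by
  rw [← sum_muHat_sub_meanReward μ x hN B]
  rw [index, bonus_eq Γ lam hN, ← Real.sqrt_mul (by positivity)] at h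
  rw [← neg_sq]
  have hsqrt := lt_sub_iff_add_lt'.2 h
  rw [← neg_sub] at hsqrt
  exact (Real.sqrt_lt' ((Real.sqrt_nonneg _).trans_lt hsqrt)).1 hsqrt

/-- The event that, before stage `t`, every arm was pulled and the index of the action `B` is below
its mean reward. -/
def pessimismEvent (m : ℕ) (Γ : Matrix (Fin d) (Fin d) ℝ) (lam : ℝ) (X : ℕ → Ω → Fin d → ℝ)
    (μ : Fin d → ℝ) (A : ℕ → Ω → Finset (Fin d)) (B : Finset (Fin d)) (t : ℕ) : Set Ω :=
  {ω | (∀ i, pulls (fun s => A s ω) t i ≠ 0) ∧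
    index m Γ lam (fun s => A s ω) (fun s => X s ω) t B < meanReward μ B}

theorem IsSubgaussianProcess.measure_pessimismEvent_le (hX : IsSubgaussianProcess P ℱ X μ C)
    (hA : ∀ t B, MeasurableSet[ℱ t] {ω | A (t + 1) ω = B}) (hCΓ : LePos C Γ)
    {lam : ℝ} (hlam : 0 < lam) {B : Finset (Fin d)} (hm : B.card = m) {t : ℕ} (ht : 3 ≤ t) :
    P (pessimismEvent m Γ lam X μ A B t) ≤ ENNReal.ofReal (1 / (t * Real.log t ^ 2)) := by
  obtain ⟨n, rfl⟩ : ∃ n, t = n + 1 := ⟨t - 1, by omega⟩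
  have hf := explore_nonneg (m := m) hlam ht
  have hexp := exp_neg_explore (m := m) hlam (t := n + 1) (by omega)
  have hL := one_le_log_natCast ht
  set L := Real.log (n + 1 : ℕ) with hLdef
  have hK : 0 < ⌊L⌋₊ := Nat.floor_pos.2 hL
  have hr : 1 < Real.exp (L / ⌊L⌋₊) := Real.one_lt_exp_iff.2 (by positivity)
  have hrK : (n + 1 : ℕ) ≤ Real.exp (L / ⌊L⌋₊) ^ ⌊L⌋₊ := by
    rw [← Real.exp_nat_mul, mul_div_cancel₀ _ (by positivity), hLdef, Real.exp_log (by positivity)]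
  refine (measure_mono fun ω hω => ?_).trans
    ((hX.measure_width_lt_le hA hCΓ hlam B hf hr hrK).trans (ENNReal.ofReal_le_ofReal ?_))
  · exact ⟨hω.1, lt_sq_of_index_lt_meanReward hf hω.1 hω.2⟩
  · rw [hm]
    calc (⌊L⌋₊ * √(1 + Real.exp (L / ⌊L⌋₊) / lam)) ^ m * Real.exp (-explore m lam (n + 1))
        ≤ (L * √(1 + Real.exp 1 / lam)) ^ m * Real.exp (-explore m lam (n + 1)) := by
          gcongr ?_ ^ m * _
          exact floor_mul_sqrt_le hlam hL
      _ = 1 / ((n + 1 : ℕ) * L ^ 2) := by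
          rw [hexp]
          field_simp
          ring

end Confidence

section Deviation

theorem pulls_succ (a : ℕ → Finset (Fin d)) {t : ℕ} (ht : 1 ≤ t) (i : Fin d) :
    pulls a (t + 1) i = pulls a t i + if i ∈ a t then 1 else 0 := by
  rw [pulls, pulls, Finset.card_filter, Finset.card_filter, Finset.sum_Ico_succ_top ht]

theorem pulls_mono (a : ℕ → Finset (Fin d)) (i : Fin d) : Monotone fun t => pulls a t i :=
  fun _ _ h => Finset.card_le_card
    (Finset.filter_subset_filter _ (Finset.Ico_subset_Ico_right h))

theorem pulls_lt_pulls (a : ℕ → Finset (Fin d)) {i : Fin d} {s t : ℕ} (hs : 1 ≤ s) (hst : s < t)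
    (hi : i ∈ a s) : pulls a s i < pulls a t i := by
  refine lt_of_lt_of_le ?_ (pulls_mono a i (Nat.succ_le_of_lt hst))
  simp only [Nat.succ_eq_add_one, pulls_succ a hs, hi, if_true, Nat.lt_succ_self]

/-- The run of actions that performs only the first `n` pulls of arm `i` of the run `a`, and none
of the other pulls. It is again predictable, so that the noise of arm `i` can be truncated after a
number of pulls rather than at a stage. -/
def firstPulls (a : ℕ → Finset (Fin d)) (i : Fin d) (n s : ℕ) : Finset (Fin d) :=
  if i ∈ a s ∧ pulls a s i < n then {i} else ∅

theorem filter_mem_firstPulls (a : ℕ → Finset (Fin d)) {i : Fin d} {n t T : ℕ} (htT : t ≤ T)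
    (hn : pulls a t i = n) :
    (Finset.Ico 1 T).filter (fun s => i ∈ firstPulls a i n s) =
      (Finset.Ico 1 t).filter (fun s => i ∈ a s) := by
  have hmem (s : ℕ) : i ∈ firstPulls a i n s ↔ i ∈ a s ∧ pulls a s i < n := by
    unfold firstPulls
    split_ifs with h <;> simp [h]
  ext s
  simp only [Finset.mem_filter, Finset.mem_Ico, hmem]
  refine ⟨fun ⟨⟨hs, _⟩, hi, hlt⟩ => ⟨⟨hs, ?_⟩, hi⟩, fun ⟨⟨hs, hst⟩, hi⟩ =>
    ⟨⟨hs, hst.trans_le htT⟩, hi, hn ▸ pulls_lt_pulls a hs hst hi⟩⟩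
  by_contra! hts
  exact (hn ▸ hlt).not_ge (pulls_mono a i hts)

theorem dependsOn_pulls (t : ℕ) (i : Fin d) :
    DependsOn (fun a => pulls a t i) (Set.Ico 1 t) := fun a b h => by
  refine congrArg Finset.card (Finset.filter_congr fun s hs => ?_)
  rw [h s (by simpa using hs)]

theorem sum_exp_neg_mul_le {x : ℝ} (hx : 0 < x) (T : ℕ) :
    ∑ n ∈ Finset.Icc 1 T, Real.exp (-(n * x)) ≤ 1 / x := by
  have hgeom := geom_sum_Ico_le_of_lt_one (m := 1) (n := T + 1) (Real.exp_nonneg (-x))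
    (Real.exp_lt_one_iff.2 (neg_lt_zero.2 hx))
  calc ∑ n ∈ Finset.Icc 1 T, Real.exp (-(n * x)) = ∑ n ∈ Finset.Ico 1 (T + 1), Real.exp (-x) ^ n :=
        Finset.sum_congr rfl fun n _ => by rw [← Real.exp_nat_mul, mul_neg]
    _ ≤ Real.exp (-x) ^ 1 / (1 - Real.exp (-x)) := hgeom
    _ = 1 / (Real.exp x - 1) := by
        rw [pow_one, Real.exp_neg]
        field_simp
    _ ≤ 1 / x := one_div_le_one_div_of_le hx (by linarith [Real.add_one_le_exp x])

/-- The event that, at some stage `t ≤ T` before which arm `i` was pulled `n` times, the average of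
these `n` rewards exceeds its mean by at least `ε`. -/
def deviationEvent (X : ℕ → Ω → Fin d → ℝ) (μ : Fin d → ℝ) (A : ℕ → Ω → Finset (Fin d))
    (T : ℕ) (ε : ℝ) (i : Fin d) (n : ℕ) : Set Ω :=
  {ω | ∃ t ≤ T, pulls (fun s => A s ω) t i = n ∧
    n * ε ≤ noiseSum μ (fun s => A s ω) (fun s => X s ω) t i}

variable [mΩ : MeasurableSpace Ω] {P : Measure Ω} {ℱ : Filtration ℕ mΩ}
  {X : ℕ → Ω → Fin d → ℝ} {μ : Fin d → ℝ} {C : Matrix (Fin d) (Fin d) ℝ}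
  {A : ℕ → Ω → Finset (Fin d)}

theorem measurableSet_firstPulls_eq (hA : ∀ t B, MeasurableSet[ℱ t] {ω | A (t + 1) ω = B})
    (i : Fin d) (n t : ℕ) (B : Finset (Fin d)) :
    MeasurableSet[ℱ t] {ω | firstPulls (fun s => A s ω) i n (t + 1) = B} := by
  refine @measurableSet_setOfPred _ (ℱ t) _ |>.2 (measurable_of_dependsOn_actions (n := t)
    (H := fun a => firstPulls a i n (t + 1) = B) hA fun a b h => ?_)
  have hpulls := dependsOn_pulls (t + 1) i (x := a) (y := b)
    fun s hs => h s ⟨hs.1, hs.2.le⟩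
  simp only at hpulls
  simp only [firstPulls, h (t + 1) ⟨Nat.le_add_left 1 t, le_rfl⟩, hpulls]

namespace IsSubgaussianProcess

variable [IsProbabilityMeasure P]

theorem measure_deviationEvent_le (hX : IsSubgaussianProcess P ℱ X μ C)
    (hA : ∀ t B, MeasurableSet[ℱ t] {ω | A (t + 1) ω = B}) {ε c : ℝ} (hε : 0 ≤ ε) (hc : 0 < c)
    {i : Fin d} (hCc : C i i ≤ c) (T n : ℕ) :
    P (deviationEvent X μ A T ε i n) ≤
      ENNReal.ofReal (Real.exp (-(n * (ε ^ 2 / (2 * c))))) := by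
  have hA' := measurableSet_firstPulls_eq hA i n
  have hpair := hX.isCanonicalPair (A := fun s ω => firstPulls (fun s => A s ω) i n s) hA' T
  obtain ⟨u, hu⟩ : ∃ u : Fin d → ℝ, u = Pi.single i (ε / c) := ⟨_, rfl⟩
  refine (measure_mono ?_).trans (measure_ofReal_inv_le_le
    (hpair.measurable_exp.comp (measurable_prodMk_right (y := u))).ennreal_ofReal.aemeasurable
    (hX.lintegral_exp_noiseSum_le_one (A := fun s ω => firstPulls (fun s => A s ω) i n s) hA' u T)
    (Real.exp_pos _))
  rintro ω ⟨t, htT, hn, hdev⟩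
  have hfilter := filter_mem_firstPulls (fun s => A s ω) (htT.trans (Nat.le_succ T)) hn
  have hnoise : noiseSum μ (fun s => firstPulls (fun s => A s ω) i n s) (fun s => X s ω) (T + 1) i =
      noiseSum μ (fun s => A s ω) (fun s => X s ω) t i := by
    rw [noiseSum_apply, noiseSum_apply, hfilter]
  have hcov : covSum C (fun s => firstPulls (fun s => A s ω) i n s) (T + 1) i i = n * C i i := by
    rw [covSum_apply, jointPulls_self, pulls, hfilter, ← hn, pulls]
  rw [Set.mem_ofPred_eq, ← ENNReal.ofReal_inv_of_pos (Real.exp_pos _), ← Real.exp_neg, neg_neg]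
  refine ENNReal.ofReal_le_ofReal (Real.exp_le_exp.2 ?_)
  simp only [hu, single_dotProduct, Matrix.mulVec_single, hnoise, Matrix.col_apply, Pi.smul_apply,
    hcov, MulOpposite.smul_eq_mul_unop, MulOpposite.unop_op]
  calc n * (ε ^ 2 / (2 * c)) = ε / c * (n * ε) - 1 / 2 * (ε / c * (n * c * (ε / c))) := by
        field_simp
        ring
    _ ≤ _ := by gcongr

theorem sum_measure_deviationEvent_le (hX : IsSubgaussianProcess P ℱ X μ C)
    (hA : ∀ t B, MeasurableSet[ℱ t] {ω | A (t + 1) ω = B}) {ε : ℝ} (hε : 0 < ε)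
    (i : Fin d) (T : ℕ) :
    ∑ n ∈ Finset.Icc 1 T, P.real (deviationEvent X μ A T ε i n) ≤ 2 * C i i / ε ^ 2 := by
  have hC0 : 0 ≤ C i i := hX.posSemidef.diag_nonneg
  have hbound (c : ℝ) (hc : C i i < c) :
      (∑ n ∈ Finset.Icc 1 T, P.real (deviationEvent X μ A T ε i n)) * ε ^ 2 / 2 ≤ c := by
    have hc0 : 0 < c := hC0.trans_lt hc
    have hsum : ∑ n ∈ Finset.Icc 1 T, P.real (deviationEvent X μ A T ε i n) ≤
        1 / (ε ^ 2 / (2 * c)) :=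
      (Finset.sum_le_sum fun n _ => ENNReal.toReal_le_of_le_ofReal (Real.exp_nonneg _)
        (hX.measure_deviationEvent_le hA hε.le hc0 hc.le T n)).trans
        (sum_exp_neg_mul_le (by positivity) T)
    calc _ ≤ 1 / (ε ^ 2 / (2 * c)) * ε ^ 2 / 2 := by gcongr
      _ = c := by field_simp
  have hlim := le_of_forall_gt_imp_ge_of_dense hbound
  rw [le_div_iff₀ (by positivity)]
  linarith

end IsSubgaussianProcess

end Deviation

section Series

theorem inv_succ_le_log_sub_log {n : ℕ} (hn : 1 ≤ n) :
    1 / ((n + 1 : ℕ) : ℝ) ≤ Real.log (n + 1 : ℕ) - Real.log n := by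
  have hn0 : (0 : ℝ) < n := by exact_mod_cast hn
  rw [← Real.log_div (by positivity) hn0.ne']
  refine le_trans (le_of_eq ?_) (Real.one_sub_inv_le_log_of_pos (by positivity))
  push_cast
  field_simp
  ring

theorem sum_Ioc_inv_le_log_sub_log {k n : ℕ} (hk : 1 ≤ k) (hkn : k ≤ n) :
    ∑ N ∈ Finset.Ioc k n, 1 / (N : ℝ) ≤ Real.log n - Real.log k := by
  induction n, hkn using Nat.le_induction with
  | base => simp
  | succ n hkn ih =>
    rw [← Finset.sum_Ioc_consecutive _ hkn n.le_succ, Nat.Ioc_succ_singleton,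
      Finset.sum_singleton]
    linarith [inv_succ_le_log_sub_log (hk.trans hkn)]

theorem inv_mul_log_sq_le {n : ℕ} (hn : 2 ≤ n) :
    1 / ((n + 1 : ℕ) * Real.log (n + 1 : ℕ) ^ 2) ≤
      1 / Real.log n - 1 / Real.log (n + 1 : ℕ) := by
  have hstep := inv_succ_le_log_sub_log (one_le_two.trans hn)
  have hlog : 0 < Real.log n := Real.log_pos (by exact_mod_cast hn)
  have hlog' : Real.log n ≤ Real.log (n + 1 : ℕ) :=
    Real.log_le_log (by positivity) (by exact_mod_cast n.le_succ)
  generalize Real.log (n + 1 : ℕ) = L' at *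
  generalize Real.log n = L at *
  have hL' : 0 < L' := hlog.trans_le hlog'
  calc 1 / ((n + 1 : ℕ) * L' ^ 2) = 1 / ((n + 1 : ℕ) : ℝ) / L' ^ 2 := by rw [div_div]
    _ ≤ (L' - L) / (L * L') := div_le_div₀ (by linarith) hstep (by positivity) (by nlinarith)
    _ = 1 / L - 1 / L' := by field_simp

theorem sum_inv_mul_log_sq_le (T : ℕ) :
    ∑ t ∈ Finset.Icc 3 T, 1 / (t * Real.log t ^ 2) ≤ 2 := by
  have htele (n : ℕ) (hn : 2 ≤ n) : ∑ t ∈ Finset.Icc 3 n, 1 / (t * Real.log t ^ 2) ≤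
      1 / Real.log 2 - 1 / Real.log n := by
    induction n, hn using Nat.le_induction with
    | base => simp
    | succ n hn ih =>
      rw [Finset.sum_Icc_succ_top (by omega)]
      linarith [inv_mul_log_sq_le hn]
  rcases lt_or_ge T 2 with hT | hT
  · rw [Finset.Icc_eq_empty (by omega)]
    simp
  · have hlog2 : 1 / Real.log 2 ≤ 2 := by
      rw [div_le_iff₀ (by positivity)]
      linarith [Real.log_two_gt_d9]
    have hlogT : 0 ≤ 1 / Real.log T := one_div_nonneg.2 (Real.log_natCast_nonneg T)
    linarith [htele T hT]

theorem sum_inv_sqrt_le (n : ℕ) : ∑ N ∈ Finset.Icc 1 n, 1 / √(N : ℝ) ≤ 2 * √(n : ℝ) := by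
  induction n with
  | zero => simp
  | succ n ih =>
    have hpos : 0 < √((n + 1 : ℕ) : ℝ) := Real.sqrt_pos.2 (by positivity)
    have hstep : 1 / √((n + 1 : ℕ) : ℝ) ≤ 2 * √((n + 1 : ℕ) : ℝ) - 2 * √(n : ℝ) := by
      rw [div_le_iff₀ hpos]
      have hsq : √((n + 1 : ℕ) : ℝ) ^ 2 = √(n : ℝ) ^ 2 + 1 := by
        rw [Real.sq_sqrt (by positivity), Real.sq_sqrt (by positivity), Nat.cast_succ]
      nlinarith [sq_nonneg (√((n + 1 : ℕ) : ℝ) - √(n : ℝ))]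
    rw [Finset.sum_Icc_succ_top (by omega)]
    linarith

theorem sum_sqrt_div_le {K : ℝ} (hK : 0 ≤ K) (n : ℕ) :
    ∑ N ∈ Finset.Icc 1 n, √(K / N) ≤ 2 * √(K * n) :=
  calc ∑ N ∈ Finset.Icc 1 n, √(K / N) = √K * ∑ N ∈ Finset.Icc 1 n, 1 / √(N : ℝ) := by
        rw [Finset.mul_sum]
        exact Finset.sum_congr rfl fun N _ => by rw [Real.sqrt_div hK, mul_one_div]
    _ ≤ √K * (2 * √(n : ℝ)) := by gcongr; exact sum_inv_sqrt_le n
    _ = 2 * √(K * n) := by rw [Real.sqrt_mul hK]; ring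

theorem sum_Ioc_floor_div_le {K : ℝ} (hK : 0 < K) {n : ℕ} (hn : ⌊K⌋₊ < n) :
    ∑ N ∈ Finset.Ioc ⌊K⌋₊ n, K / N ≤
      K * (1 / (⌊K⌋₊ + 1 : ℕ) + Real.log n - Real.log (⌊K⌋₊ + 1 : ℕ)) := by
  have htail := sum_Ioc_inv_le_log_sub_log (Nat.le_add_left 1 ⌊K⌋₊) hn
  calc ∑ N ∈ Finset.Ioc ⌊K⌋₊ n, K / N = K * ∑ N ∈ Finset.Ioc ⌊K⌋₊ n, 1 / (N : ℝ) := by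
        rw [Finset.mul_sum]
        exact Finset.sum_congr rfl fun N _ => by rw [mul_one_div]
    _ = K * (1 / (⌊K⌋₊ + 1 : ℕ) + ∑ N ∈ Finset.Ioc (⌊K⌋₊ + 1) n, 1 / (N : ℝ)) := by
        rw [← Finset.sum_Ioc_consecutive _ ⌊K⌋₊.le_succ hn, Nat.Ioc_succ_singleton,
          Finset.sum_singleton]
    _ ≤ _ := by
        gcongr
        linarith

theorem two_mul_sqrt_mul_floor_add_le {K : ℝ} (hK : 0 < K) :
    2 * √(K * ⌊K⌋₊) + K * (1 / (⌊K⌋₊ + 1 : ℕ) + Real.log K - Real.log (⌊K⌋₊ + 1 : ℕ)) ≤ 2 * K := by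
  have hfloor : (⌊K⌋₊ : ℝ) ≤ K := Nat.floor_le hK.le
  have hlt : K < ⌊K⌋₊ + 1 := Nat.lt_floor_add_one K
  have hk0 : (0 : ℝ) ≤ ⌊K⌋₊ := Nat.cast_nonneg _
  rw [Nat.cast_succ]
  generalize (⌊K⌋₊ : ℝ) = k at *
  have hk : 0 < k + 1 := hK.trans hlt
  have hsqrt : 2 * √(K * k) ≤ K + k := by
    have hsq := sq_nonneg (√K - √k)
    rw [sub_sq, Real.sq_sqrt hK.le, Real.sq_sqrt hk0, mul_assoc, ← Real.sqrt_mul hK.le] at hsq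
    linarith
  have hlog : Real.log K - Real.log (k + 1) ≤ K / (k + 1) - 1 := by
    rw [← Real.log_div hK.ne' hk.ne']
    exact Real.log_le_sub_one_of_pos (by positivity)
  have hfrac : K * (1 / (k + 1) + K / (k + 1)) ≤ 2 * K - k := by
    rw [← add_div, ← mul_div_assoc, div_le_iff₀ hk]
    nlinarith
  calc 2 * √(K * k) + K * (1 / (k + 1) + Real.log K - Real.log (k + 1))
      ≤ K + k + K * (1 / (k + 1) + (K / (k + 1) - 1)) := by
        gcongr
        linarith
    _ ≤ 2 * K := by linarith

theorem sum_min_sqrt_le {K M : ℝ} (hK : 0 < K) (hKM : K ≤ M) :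
    ∑ N ∈ Finset.Icc 1 ⌊M⌋₊, min √(K / N) (K / N) ≤ K * (2 + Real.log (M / K)) := by
  have hfloor : ⌊K⌋₊ ≤ ⌊M⌋₊ := Nat.floor_mono hKM
  have hhead : ∑ N ∈ Finset.Icc 1 ⌊K⌋₊, min √(K / N) (K / N) ≤ 2 * √(K * ⌊K⌋₊) :=
    (Finset.sum_le_sum fun _ _ => min_le_left _ _).trans (sum_sqrt_div_le hK.le _)
  rcases hfloor.eq_or_lt with heq | hlt
  · have hsqrt : √(K * ⌊K⌋₊) ≤ K := by
      rw [Real.sqrt_le_left hK.le, sq]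
      exact mul_le_mul_of_nonneg_left (Nat.floor_le hK.le) hK.le
    have hlog : 0 ≤ K * Real.log (M / K) :=
      mul_nonneg hK.le (Real.log_nonneg ((one_le_div hK).2 hKM))
    rw [← heq]
    linarith
  · have htail : ∑ N ∈ Finset.Ioc ⌊K⌋₊ ⌊M⌋₊, min √(K / N) (K / N) ≤ _ :=
      (Finset.sum_le_sum fun _ _ => min_le_right _ _).trans (sum_Ioc_floor_div_le hK hlt)
    have hlog : Real.log ⌊M⌋₊ ≤ Real.log (M / K) + Real.log K := by
      rw [← Real.log_mul (div_pos (hK.trans_le hKM) hK).ne' hK.ne', div_mul_cancel₀ _ hK.ne']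
      exact Real.log_le_log (by exact_mod_cast hlt.pos) (Nat.floor_le (hK.le.trans hKM))
    have hKlog := mul_le_mul_of_nonneg_left hlog hK.le
    have hjoint := two_mul_sqrt_mul_floor_add_le hK
    have hIoc (n : ℕ) : Finset.Icc 1 n = Finset.Ioc 0 n := Finset.Icc_add_one_left_eq_Ioc 0 n
    rw [hIoc] at hhead ⊢
    rw [← Finset.sum_Ioc_consecutive _ (Nat.zero_le _) hfloor]
    linarith

end Series

section Charge

/-- The charge to an arm that was pulled `N` times, in units of its minimal gap, of a stage at
which the squared gap is at most a sum of terms proportional to `K / N` over the `m` arms played.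
Beyond `2 * m * K` pulls an arm contributes too little to the sum, and is not charged. -/
def varCharge (m : ℕ) (K : ℝ) (N : ℕ) : ℝ :=
  if (N : ℝ) ≤ 2 * m * K then 2 * min √(K / N) (K / N) else 0

/-- The charge to an arm that was pulled `N` times, in units of its minimal gap, of a stage at
which the gap is at most a sum of terms proportional to `√(K / N)` over the `m` arms played.
Beyond `4 * m ^ 2 * K` pulls an arm contributes too little to the sum, and is not charged. -/
def devCharge (m : ℕ) (K : ℝ) (N : ℕ) : ℝ :=
  if (N : ℝ) ≤ 4 * m ^ 2 * K then 2 * √(K / N) else 0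

theorem varCharge_nonneg {K : ℝ} (hK : 0 ≤ K) (N : ℕ) : 0 ≤ varCharge m K N := by
  unfold varCharge
  positivity

theorem devCharge_nonneg (m : ℕ) (K : ℝ) (N : ℕ) : 0 ≤ devCharge m K N := by
  unfold devCharge
  positivity

theorem sum_ite_le_floor (T : ℕ) {M : ℝ} {g : ℕ → ℝ} (hg : ∀ N, 0 ≤ g N) :
    ∑ N ∈ Finset.Icc 1 T, (if (N : ℝ) ≤ M then g N else 0) ≤ ∑ N ∈ Finset.Icc 1 ⌊M⌋₊, g N := by
  rw [← Finset.sum_filter]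
  refine Finset.sum_le_sum_of_subset_of_nonneg (fun N hN => ?_) fun N _ _ => hg N
  rw [Finset.mem_filter, Finset.mem_Icc] at hN
  exact Finset.mem_Icc.2 ⟨hN.1.1, Nat.le_floor hN.2⟩

theorem sum_devCharge_le {K : ℝ} (hK : 0 ≤ K) (T : ℕ) :
    ∑ N ∈ Finset.Icc 1 T, devCharge m K N ≤ 8 * m * K := by
  have hM : (0 : ℝ) ≤ 4 * m ^ 2 * K := by positivity
  calc ∑ N ∈ Finset.Icc 1 T, devCharge m K N
      ≤ ∑ N ∈ Finset.Icc 1 ⌊4 * m ^ 2 * K⌋₊, 2 * √(K / N) :=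
        sum_ite_le_floor T fun N => by positivity
    _ ≤ 2 * (2 * √(K * ⌊4 * m ^ 2 * K⌋₊)) := by
        rw [← Finset.mul_sum]
        gcongr
        exact sum_sqrt_div_le hK _
    _ ≤ 2 * (2 * √((2 * m * K) ^ 2)) := by
        gcongr
        nlinarith [mul_le_mul_of_nonneg_left (Nat.floor_le hM) hK]
    _ = 8 * m * K := by
        rw [Real.sqrt_sq (by positivity)]
        ring

theorem four_add_two_mul_log_le (hm : 1 ≤ m) :
    4 + 2 * Real.log (2 * m) ≤ 80 / 9 * (posCeil (Real.log m / 1.6) : ℝ) ^ 2 := by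
  have hceil1 : (1 : ℝ) ≤ posCeil (Real.log m / 1.6) := by exact_mod_cast le_max_left _ _
  have hceil : Real.log m / 1.6 ≤ posCeil (Real.log m / 1.6) :=
    (Nat.le_ceil _).trans (by exact_mod_cast le_max_right _ _)
  rw [Real.log_mul two_ne_zero (by positivity)]
  rw [div_le_iff₀ (by norm_num)] at hceil
  nlinarith [Real.log_two_lt_d9]

theorem sum_varCharge_le {K : ℝ} (hK : 0 ≤ K) (hm : 1 ≤ m) (T : ℕ) :
    ∑ N ∈ Finset.Icc 1 T, varCharge m K N ≤
      80 / 9 * (posCeil (Real.log m / 1.6) : ℝ) ^ 2 * K := by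
  rcases hK.eq_or_lt with rfl | hK
  · simp [varCharge]
  have hm1 : (1 : ℝ) ≤ m := by exact_mod_cast hm
  calc ∑ N ∈ Finset.Icc 1 T, varCharge m K N
      ≤ ∑ N ∈ Finset.Icc 1 ⌊2 * m * K⌋₊, 2 * min √(K / N) (K / N) :=
        sum_ite_le_floor T fun N => by positivity
    _ ≤ 2 * (K * (2 + Real.log (2 * m * K / K))) := by
        rw [← Finset.mul_sum]
        gcongr
        exact sum_min_sqrt_le hK (by nlinarith)
    _ = (4 + 2 * Real.log (2 * m)) * K := by
        rw [mul_div_cancel_right₀ _ hK.ne']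
        ring
    _ ≤ _ := by
        gcongr
        exact four_add_two_mul_log_le hm

end Charge

section Charging

variable {ι : Type*} {D : Finset ι} {δ K : ι → ℝ} {N : ι → ℕ} {Δ : ℝ}

theorem le_mul_varCharge {m N : ℕ} {Δ δ K : ℝ} (hm : 1 ≤ m) (hδ : 0 < δ) (hδΔ : δ ≤ Δ)
    (hN : 1 ≤ N) (h : Δ ^ 2 ≤ δ ^ 2 * (K / N)) : Δ ≤ δ * varCharge m K N := by
  have hm1 : (1 : ℝ) ≤ m := by exact_mod_cast hm
  have hN0 : (0 : ℝ) < N := by exact_mod_cast hN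
  have hratio : 1 ≤ K / N := by
    have hsq : δ ^ 2 * 1 ≤ δ ^ 2 * (K / N) := by
      rw [mul_one]
      exact (pow_le_pow_left₀ hδ.le hδΔ 2).trans h
    exact le_of_mul_le_mul_left hsq (by positivity)
  have hNK : (N : ℝ) ≤ K := (one_le_div hN0).1 hratio
  have hmin : √(K / N) ≤ K / N :=
    (Real.sqrt_le_left (by positivity)).2 (le_self_pow₀ hratio two_ne_zero)
  have hsqrt : Δ ≤ δ * √(K / N) :=
    (Real.le_sqrt_of_sq_le h).trans_eq (by rw [Real.sqrt_mul (sq_nonneg δ), Real.sqrt_sq hδ.le])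
  rw [varCharge, if_pos (by nlinarith), min_eq_left hmin]
  linarith [hδ.le.trans hδΔ]

theorem two_mul_div_sub_le_mul_varCharge {m N : ℕ} {Δ δ K : ℝ} (hm : 1 ≤ m) (hδ : 0 < δ)
    (hδΔ : δ ≤ Δ) (hN : 1 ≤ N) (hK : 0 ≤ K) (h : δ ^ 2 * (K / N) ≤ Δ ^ 2) :
    2 * (δ ^ 2 * (K / N)) / Δ - Δ / m ≤ δ * varCharge m K N := by
  have : (0 : ℝ) < m := by exact_mod_cast hm
  have hN0 : (0 : ℝ) < N := by exact_mod_cast hN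
  have hΔ : 0 < Δ := hδ.trans_le hδΔ
  have hlin : δ ^ 2 * (K / N) ≤ δ * (K / N) * Δ := by
    rw [sq, mul_assoc, mul_comm δ]
    nlinarith [mul_nonneg hδ.le (div_nonneg hK hN0.le)]
  unfold varCharge
  split_ifs with hcond
  · have hsqrt : δ * √(K / N) ≤ Δ := by
      rw [← Real.sqrt_sq hδ.le, ← Real.sqrt_mul (sq_nonneg δ)]
      exact (Real.sqrt_le_left hΔ.le).2 h
    have hroot : δ ^ 2 * (K / N) ≤ δ * √(K / N) * Δ :=
      calc δ ^ 2 * (K / N) = δ * √(K / N) * (δ * √(K / N)) := by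
            rw [mul_mul_mul_comm, Real.mul_self_sqrt (by positivity), sq]
        _ ≤ δ * √(K / N) * Δ := by gcongr
    have hmin : δ ^ 2 * (K / N) / Δ ≤ δ * min √(K / N) (K / N) := by
      rw [mul_min_of_nonneg _ _ hδ.le]
      exact le_min ((div_le_iff₀ hΔ).2 hroot) ((div_le_iff₀ hΔ).2 hlin)
    have hpos : 0 ≤ Δ / m := by positivity
    rw [mul_div_assoc]
    linarith
  · have hsmall : K / N ≤ 1 / (2 * m) := by
      rw [div_le_div_iff₀ hN0 (by positivity)]
      linarith
    rw [mul_zero, sub_nonpos]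
    calc 2 * (δ ^ 2 * (K / N)) / Δ ≤ 2 * (Δ ^ 2 * (1 / (2 * m))) / Δ := by gcongr
      _ = Δ / m := by field_simp

theorem le_sum_mul_varCharge (hD : D.card = m) (hm : 1 ≤ m) (hΔ : 0 < Δ)
    (hδ : ∀ i ∈ D, 0 < δ i) (hδΔ : ∀ i ∈ D, δ i ≤ Δ) (hK : ∀ i ∈ D, 0 ≤ K i)
    (hN : ∀ i ∈ D, 1 ≤ N i) (h : Δ ^ 2 ≤ ∑ i ∈ D, δ i ^ 2 * (K i / N i)) :
    Δ ≤ ∑ i ∈ D, δ i * varCharge m (K i) (N i) := by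
  by_cases hex : ∃ i ∈ D, Δ ^ 2 ≤ δ i ^ 2 * (K i / N i)
  · obtain ⟨i, hi, hle⟩ := hex
    exact (le_mul_varCharge hm (hδ i hi) (hδΔ i hi) (hN i hi) hle).trans
      (Finset.single_le_sum (f := fun i => δ i * varCharge m (K i) (N i))
        (fun j hj => mul_nonneg (hδ j hj).le (varCharge_nonneg (hK j hj) _)) hi)
  · push Not at hex
    -- The bound on `Δ ^ 2` is used twice, and its spare copy pays `Δ / m` per arm.
    calc Δ ≤ 2 * (∑ i ∈ D, δ i ^ 2 * (K i / N i)) / Δ - Δ := by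
          rw [le_sub_iff_add_le, le_div_iff₀ hΔ]
          linarith
      _ = ∑ i ∈ D, (2 * (δ i ^ 2 * (K i / N i)) / Δ - Δ / m) := by
          rw [Finset.sum_sub_distrib, Finset.sum_const, hD, nsmul_eq_mul,
            mul_div_cancel₀ _ (by positivity), ← Finset.sum_div, ← Finset.mul_sum]
      _ ≤ _ := Finset.sum_le_sum fun i hi => two_mul_div_sub_le_mul_varCharge hm (hδ i hi)
          (hδΔ i hi) (hN i hi) (hK i hi) (hex i hi).le

theorem two_mul_sub_le_mul_devCharge {m N : ℕ} {Δ δ K : ℝ} (hm : 1 ≤ m) (hδ : 0 < δ)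
    (hδΔ : δ ≤ Δ) (hN : 1 ≤ N) : 2 * (δ * √(K / N)) - Δ / m ≤ δ * devCharge m K N := by
  have : (0 : ℝ) < m := by exact_mod_cast hm
  have hN0 : (0 : ℝ) < N := by exact_mod_cast hN
  have hΔ : 0 < Δ := hδ.trans_le hδΔ
  unfold devCharge
  split_ifs with hcond
  · have hpos : 0 ≤ Δ / m := by positivity
    linarith
  · have hsmall : √(K / N) ≤ 1 / (2 * m) := by
      rw [Real.sqrt_le_left (by positivity), div_pow, div_le_div_iff₀ hN0 (by positivity)]
      linarith
    rw [mul_zero, sub_nonpos]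
    calc 2 * (δ * √(K / N)) ≤ 2 * (Δ * (1 / (2 * m))) := by gcongr
      _ = Δ / m := by field_simp

theorem le_sum_mul_devCharge (hD : D.card = m) (hm : 1 ≤ m)
    (hδ : ∀ i ∈ D, 0 < δ i) (hδΔ : ∀ i ∈ D, δ i ≤ Δ) (hN : ∀ i ∈ D, 1 ≤ N i)
    (h : Δ ≤ ∑ i ∈ D, δ i * √(K i / N i)) :
    Δ ≤ ∑ i ∈ D, δ i * devCharge m (K i) (N i) :=
  calc Δ ≤ 2 * (∑ i ∈ D, δ i * √(K i / N i)) - Δ := by linarith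
    _ = ∑ i ∈ D, (2 * (δ i * √(K i / N i)) - Δ / m) := by
        rw [Finset.sum_sub_distrib, Finset.sum_const, hD, nsmul_eq_mul,
          mul_div_cancel₀ _ (by positivity), ← Finset.mul_sum]
    _ ≤ _ := Finset.sum_le_sum fun i hi =>
        two_mul_sub_le_mul_devCharge hm (hδ i hi) (hδΔ i hi) (hN i hi)

theorem injOn_pulls (a : ℕ → Finset (Fin d)) (i : Fin d) :
    Set.InjOn (fun t => pulls a t i) {t | 1 ≤ t ∧ i ∈ a t} := by
  intro s hs t ht hst
  by_contra hne
  rcases lt_or_gt_of_ne hne with hlt | hlt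
  · exact (pulls_lt_pulls a hs.1 hlt hs.2).ne hst
  · exact (pulls_lt_pulls a ht.1 hlt ht.2).ne' hst

theorem sum_apply_pulls_le {a : ℕ → Finset (Fin d)} {S : Finset ℕ} {I : Finset (Fin d)} {T : ℕ}
    (hS : S ⊆ Finset.Icc 1 T) (hI : ∀ t ∈ S, a t ⊆ I)
    (hN : ∀ t ∈ S, ∀ i ∈ a t, pulls a t i ≠ 0) {h : Fin d → ℕ → ℝ} (hh : ∀ i ∈ I, ∀ n, 0 ≤ h i n) :
    ∑ t ∈ S, ∑ i ∈ a t, h i (pulls a t i) ≤ ∑ i ∈ I, ∑ n ∈ Finset.Icc 1 T, h i n := by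
  have hswap : ∑ t ∈ S, ∑ i ∈ a t, h i (pulls a t i) =
      ∑ i ∈ I, ∑ t ∈ S.filter (fun t => i ∈ a t), h i (pulls a t i) := by
    refine Finset.sum_comm' fun t i => ?_
    rw [Finset.mem_filter]
    exact ⟨fun h => ⟨h, hI t h.1 h.2⟩, fun h => h.1⟩
  rw [hswap]
  refine Finset.sum_le_sum fun i hi => ?_
  have hinj : Set.InjOn (fun t => pulls a t i) (S.filter (fun t => i ∈ a t)) :=
    (injOn_pulls a i).mono fun t ht => by
      rw [Finset.mem_coe, Finset.mem_filter] at ht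
      exact ⟨(Finset.mem_Icc.1 (hS ht.1)).1, ht.2⟩
  rw [← Finset.sum_image hinj (f := h i)]
  refine Finset.sum_le_sum_of_subset_of_nonneg (fun n hn => ?_) fun n _ _ => hh i hi n
  obtain ⟨t, ht, rfl⟩ := Finset.mem_image.1 hn
  obtain ⟨htS, hti⟩ := Finset.mem_filter.1 ht
  obtain ⟨ht1, htT⟩ := Finset.mem_Icc.1 (hS htS)
  obtain ⟨n, rfl⟩ : ∃ n, t = n + 1 := ⟨t - 1, by omega⟩
  exact Finset.mem_Icc.2
    ⟨Nat.one_le_iff_ne_zero.2 (hN _ htS i hti), ((pulls_lt a n i).trans_le htT).le⟩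

end Charging

section Gaps

variable (𝒜 : ActionSet d m) (μ : Fin d → ℝ)

theorem armPosGaps_finite (i : Fin d) : (armPosGaps 𝒜 μ i).Finite := by
  refine (𝒜.acts.finite_toSet.image (gap 𝒜 μ)).subset ?_
  rintro x ⟨A, hA, _, _, rfl⟩
  exact ⟨A, hA, rfl⟩

theorem armGapMin_pos {i : Fin d} (h : (armPosGaps 𝒜 μ i).Nonempty) : 0 < armGapMin 𝒜 μ i := by
  obtain ⟨A, _, _, hpos, heq⟩ := h.csInf_mem (armPosGaps_finite 𝒜 μ i)
  rwa [armGapMin, heq]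

theorem complexity_nonneg {Γ : Matrix (Fin d) (Fin d) ℝ} (hΓ0 : ∀ i, 0 ≤ Γ i i) :
    0 ≤ complexity 𝒜 μ Γ := by
  classical
  exact Finset.sum_nonneg fun i hi =>
    div_nonneg (hΓ0 i) (armGapMin_pos 𝒜 μ (Finset.mem_filter.1 hi).2).le

theorem posGaps_finite : (posGaps 𝒜 μ).Finite := by
  refine (𝒜.acts.finite_toSet.image (gap 𝒜 μ)).subset ?_
  rintro x ⟨A, hA, _, rfl⟩
  exact ⟨A, hA, rfl⟩

theorem gapMin_pos (h : (posGaps 𝒜 μ).Nonempty) : 0 < gapMin 𝒜 μ := by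
  obtain ⟨A, _, hpos, heq⟩ := h.csInf_mem (posGaps_finite 𝒜 μ)
  rwa [gapMin, heq]

variable {𝒜 μ} {A : Finset (Fin d)}

theorem gapMin_le (hA : A ∈ 𝒜.acts) (h : 0 < gap 𝒜 μ A) : gapMin 𝒜 μ ≤ gap 𝒜 μ A :=
  csInf_le (posGaps_finite 𝒜 μ).bddBelow ⟨A, hA, h, rfl⟩

theorem armGapMin_le (hA : A ∈ 𝒜.acts) (h : 0 < gap 𝒜 μ A) {i : Fin d} (hi : i ∈ A) :
    armGapMin 𝒜 μ i ≤ gap 𝒜 μ A :=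
  csInf_le (armPosGaps_finite 𝒜 μ i).bddBelow ⟨A, hA, hi, h, rfl⟩

theorem gap_nonneg (hA : A ∈ 𝒜.acts) : 0 ≤ gap 𝒜 μ A :=
  sub_nonneg.2 (Finset.le_sup' _ hA)

theorem gap_le_gapMax (hA : A ∈ 𝒜.acts) : gap 𝒜 μ A ≤ gapMax 𝒜 μ :=
  Finset.le_sup' _ hA

theorem gapMax_nonneg : 0 ≤ gapMax 𝒜 μ := by
  obtain ⟨A, hA⟩ := 𝒜.nonempty
  exact (gap_nonneg hA).trans (gap_le_gapMax hA)

theorem gapMax_eq_zero (h : posGaps 𝒜 μ = ∅) : gapMax 𝒜 μ = 0 :=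
  le_antisymm (Finset.sup'_le _ _ fun A hA => not_lt.1 fun hpos => h.subset ⟨A, hA, hpos, rfl⟩)
    gapMax_nonneg

end Gaps

section GoodStages

variable {𝒜 : ActionSet d m} {μ : Fin d → ℝ} {Γ : Matrix (Fin d) (Fin d) ℝ} {lam : ℝ}
  {a : ℕ → Finset (Fin d)} {t T : ℕ} {S : Finset ℕ}

theorem explore_mono (m : ℕ) (lam : ℝ) (ht : 2 ≤ t) (htT : t ≤ T) :
    explore m lam t ≤ explore m lam T := by
  have h2 : (2 : ℝ) ≤ t := by exact_mod_cast ht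
  have hlog : Real.log t ≤ Real.log T :=
    Real.log_le_log (by linarith) (by exact_mod_cast htT)
  have hloglog : Real.log (Real.log t) ≤ Real.log (Real.log T) :=
    Real.log_le_log (Real.log_pos (by linarith)) hlog
  unfold explore
  gcongr

theorem sq_le_of_le_two_mul_bonus (hΓ : Γ.PosSemidef) (hΓ0 : ∀ i j, 0 ≤ Γ i j) (hlam : 0 ≤ lam)
    (ht : t ∈ Finset.Icc 2 T) (hN : ∀ i, pulls a t i ≠ 0) {Δ : ℝ} (hΔ : 0 ≤ Δ)
    (hle : Δ ≤ 2 * bonus m Γ lam a t (a t)) :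
    Δ ^ 2 ≤ 8 * max (explore m lam T) 0 *
      ((lam + 1 - maxCorr Γ a T) * ∑ i ∈ a t, Γ i i / pulls a t i +
        maxCorr Γ a T * (∑ i ∈ a t, √(Γ i i / pulls a t i)) ^ 2) := by
  obtain ⟨ht2, htT⟩ := Finset.mem_Icc.1 ht
  have hwidth := avgVec_regCovSum_le hΓ hΓ0 lam (Finset.mem_Icc.2 ⟨by omega, htT⟩) hN
  have hf : explore m lam t ≤ max (explore m lam T) 0 :=
    (explore_mono m lam ht2 htT).trans (le_max_left _ _)
  have hf0 : 0 ≤ max (explore m lam T) 0 := le_max_right _ _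
  have hW0 : 0 ≤ (lam + 1 - maxCorr Γ a T) * ∑ i ∈ a t, Γ i i / pulls a t i +
      maxCorr Γ a T * (∑ i ∈ a t, √(Γ i i / pulls a t i)) ^ 2 :=
    add_nonneg
      (mul_nonneg (by linarith [maxCorr_le_one hΓ a T])
        (Finset.sum_nonneg fun i _ => div_nonneg (hΓ0 i i) (Nat.cast_nonneg _)))
      (mul_nonneg (maxCorr_nonneg hΓ0 a T) (sq_nonneg _))
  rw [bonus_eq Γ lam hN] at hle
  set W := (lam + 1 - maxCorr Γ a T) * ∑ i ∈ a t, Γ i i / pulls a t i +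
    maxCorr Γ a T * (∑ i ∈ a t, √(Γ i i / pulls a t i)) ^ 2
  set f := max (explore m lam T) 0
  calc Δ ^ 2 ≤ (2 * (√(2 * f) * √W)) ^ 2 := by
        gcongr
        exact hle.trans (by gcongr)
    _ = 8 * f * W := by
        rw [mul_pow, mul_pow, Real.sq_sqrt (by positivity), Real.sq_sqrt hW0]
        ring

theorem sum_gap_le_mul_complexity (hΓ0 : ∀ i, 0 ≤ Γ i i) {θ b : ℝ} (hθ : 0 ≤ θ)
    {c : ℝ → ℕ → ℝ} (hc0 : ∀ K, 0 ≤ K → ∀ N, 0 ≤ c K N)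
    (hc : ∀ K, 0 ≤ K → ∑ N ∈ Finset.Icc 1 T, c K N ≤ b * K) (hS : S ⊆ Finset.Icc 1 T)
    (ha : ∀ t ∈ S, a t ∈ 𝒜.acts) (hN : ∀ t ∈ S, ∀ i ∈ a t, pulls a t i ≠ 0)
    (hpos : ∀ t ∈ S, 0 < gap 𝒜 μ (a t))
    (hle : ∀ t ∈ S, gap 𝒜 μ (a t) ≤ ∑ i ∈ a t, armGapMin 𝒜 μ i *
      c (θ * Γ i i / armGapMin 𝒜 μ i ^ 2) (pulls a t i)) :
    ∑ t ∈ S, gap 𝒜 μ (a t) ≤ θ * b * complexity 𝒜 μ Γ := by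
  classical
  set I := Finset.univ.filter fun i => (armPosGaps 𝒜 μ i).Nonempty
  have hδ : ∀ i ∈ I, 0 < armGapMin 𝒜 μ i := fun i hi =>
    armGapMin_pos 𝒜 μ (Finset.mem_filter.1 hi).2
  have hK (i : Fin d) : 0 ≤ θ * Γ i i / armGapMin 𝒜 μ i ^ 2 :=
    div_nonneg (mul_nonneg hθ (hΓ0 i)) (sq_nonneg _)
  have hSI : ∀ t ∈ S, a t ⊆ I := fun t ht i hi =>
    Finset.mem_filter.2 ⟨Finset.mem_univ _, _, a t, ha t ht, hi, hpos t ht, rfl⟩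
  calc ∑ t ∈ S, gap 𝒜 μ (a t)
      ≤ ∑ t ∈ S, ∑ i ∈ a t, armGapMin 𝒜 μ i *
          c (θ * Γ i i / armGapMin 𝒜 μ i ^ 2) (pulls a t i) := Finset.sum_le_sum hle
    _ ≤ ∑ i ∈ I, ∑ n ∈ Finset.Icc 1 T, armGapMin 𝒜 μ i *
          c (θ * Γ i i / armGapMin 𝒜 μ i ^ 2) n :=
        sum_apply_pulls_le (h := fun i n => armGapMin 𝒜 μ i *
          c (θ * Γ i i / armGapMin 𝒜 μ i ^ 2) n) hS hSI hN
          fun i hi n => mul_nonneg (hδ i hi).le (hc0 _ (hK i) n)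
    _ ≤ ∑ i ∈ I, θ * b * (Γ i i / armGapMin 𝒜 μ i) := by
        refine Finset.sum_le_sum fun i hi => ?_
        have hδi := hδ i hi
        rw [← Finset.mul_sum]
        refine (mul_le_mul_of_nonneg_left (hc _ (hK i)) hδi.le).trans_eq ?_
        field_simp
    _ = θ * b * complexity 𝒜 μ Γ := by
        rw [← Finset.mul_sum, complexity]

theorem sum_gap_le_of_sq_le_var (hm : 1 ≤ m) (hΓ0 : ∀ i, 0 ≤ Γ i i) {θ : ℝ} (hθ : 0 ≤ θ)
    (hS : S ⊆ Finset.Icc 1 T) (ha : ∀ t ∈ S, a t ∈ 𝒜.acts)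
    (hN : ∀ t ∈ S, ∀ i ∈ a t, pulls a t i ≠ 0) (hpos : ∀ t ∈ S, 0 < gap 𝒜 μ (a t))
    (hle : ∀ t ∈ S, gap 𝒜 μ (a t) ^ 2 ≤ θ * ∑ i ∈ a t, Γ i i / pulls a t i) :
    ∑ t ∈ S, gap 𝒜 μ (a t) ≤
      θ * (80 / 9 * (posCeil (Real.log m / 1.6) : ℝ) ^ 2) * complexity 𝒜 μ Γ := by
  refine sum_gap_le_mul_complexity hΓ0 hθ (c := varCharge m) (fun K hK N => varCharge_nonneg hK N)
    (fun K hK => sum_varCharge_le hK hm T) hS ha hN hpos fun t ht => ?_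
  have hδ (i : Fin d) (hi : i ∈ a t) : 0 < armGapMin 𝒜 μ i :=
    armGapMin_pos 𝒜 μ ⟨_, a t, ha t ht, hi, hpos t ht, rfl⟩
  refine le_sum_mul_varCharge (𝒜.card_eq _ (ha t ht)) hm (hpos t ht) hδ
    (fun i hi => armGapMin_le (ha t ht) (hpos t ht) hi)
    (fun i _ => div_nonneg (mul_nonneg hθ (hΓ0 i)) (sq_nonneg _))
    (fun i hi => Nat.one_le_iff_ne_zero.2 (hN t ht i hi)) ((hle t ht).trans_eq ?_)
  rw [Finset.mul_sum]
  refine Finset.sum_congr rfl fun i hi => ?_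
  have hδi := hδ i hi
  field_simp

theorem sum_gap_le_of_sq_le_dev (hm : 1 ≤ m) (hΓ0 : ∀ i, 0 ≤ Γ i i) {θ : ℝ} (hθ : 0 ≤ θ)
    (hS : S ⊆ Finset.Icc 1 T) (ha : ∀ t ∈ S, a t ∈ 𝒜.acts)
    (hN : ∀ t ∈ S, ∀ i ∈ a t, pulls a t i ≠ 0) (hpos : ∀ t ∈ S, 0 < gap 𝒜 μ (a t))
    (hle : ∀ t ∈ S, gap 𝒜 μ (a t) ^ 2 ≤ θ * (∑ i ∈ a t, √(Γ i i / pulls a t i)) ^ 2) :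
    ∑ t ∈ S, gap 𝒜 μ (a t) ≤ θ * (8 * m) * complexity 𝒜 μ Γ := by
  refine sum_gap_le_mul_complexity hΓ0 hθ (c := devCharge m) (fun K _ N => devCharge_nonneg m K N)
    (fun K hK => sum_devCharge_le hK T) hS ha hN hpos fun t ht => ?_
  have hδ (i : Fin d) (hi : i ∈ a t) : 0 < armGapMin 𝒜 μ i :=
    armGapMin_pos 𝒜 μ ⟨_, a t, ha t ht, hi, hpos t ht, rfl⟩
  refine le_sum_mul_devCharge (𝒜.card_eq _ (ha t ht)) hm hδ
    (fun i hi => armGapMin_le (ha t ht) (hpos t ht) hi)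
    (fun i hi => Nat.one_le_iff_ne_zero.2 (hN t ht i hi)) ?_
  calc gap 𝒜 μ (a t) ≤ √(θ * (∑ i ∈ a t, √(Γ i i / pulls a t i)) ^ 2) :=
        Real.le_sqrt_of_sq_le (hle t ht)
    _ = ∑ i ∈ a t, √θ * √(Γ i i / pulls a t i) := by
        rw [Real.sqrt_mul hθ, Real.sqrt_sq (Finset.sum_nonneg fun i _ => Real.sqrt_nonneg _),
          Finset.mul_sum]
    _ = ∑ i ∈ a t, armGapMin 𝒜 μ i *
          √(θ * Γ i i / armGapMin 𝒜 μ i ^ 2 / pulls a t i) := by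
        refine Finset.sum_congr rfl fun i hi => ?_
        have hδi := hδ i hi
        rw [← Real.sqrt_mul hθ, ← Real.sqrt_sq hδi.le, ← Real.sqrt_mul (sq_nonneg _),
          Real.sqrt_sq hδi.le]
        congr 1
        field_simp

theorem sum_gap_le_of_gap_le_two_mul_bonus (hm : 1 ≤ m) (hΓ : Γ.PosSemidef)
    (hΓ0 : ∀ i j, 0 ≤ Γ i j) (hlam : 0 ≤ lam) (hS : S ⊆ Finset.Icc 2 T)
    (ha : ∀ t ∈ S, a t ∈ 𝒜.acts) (hN : ∀ t ∈ S, ∀ i, pulls a t i ≠ 0)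
    (hpos : ∀ t ∈ S, 0 < gap 𝒜 μ (a t))
    (hle : ∀ t ∈ S, gap 𝒜 μ (a t) ≤ 2 * bonus m Γ lam a t (a t)) :
    ∑ t ∈ S, gap 𝒜 μ (a t) ≤ 16 * max (explore m lam T) 0 * complexity 𝒜 μ Γ *
      (5 * (lam + 1 - maxCorr Γ a T) * (posCeil (Real.log m / 1.6) : ℝ) ^ 2
        + 45 * maxCorr Γ a T * m) := by
  classical
  have hf0 : 0 ≤ max (explore m lam T) 0 := le_max_right _ _
  have hγ0 := maxCorr_nonneg hΓ0 a T
  have hb0 : 0 ≤ lam + 1 - maxCorr Γ a T := by linarith [maxCorr_le_one hΓ a T]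
  have hcplx0 := complexity_nonneg 𝒜 μ fun i => hΓ0 i i
  have hsq := fun t ht => sq_le_of_le_two_mul_bonus hΓ hΓ0 hlam (hS ht) (hN t ht) (hpos t ht).le
    (hle t ht)
  set f := max (explore m lam T) 0
  set γ := maxCorr Γ a T
  set b := lam + 1 - γ
  -- Where `Δ² ≤ 8 f (b x + γ y²)` but `f b x < Δ² / 9`, the second term gives `Δ² ≤ 72 f γ y²`.
  let p : ℕ → Prop := fun t => gap 𝒜 μ (a t) ^ 2 ≤ 9 * f * b * ∑ i ∈ a t, Γ i i / pulls a t i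
  have hsub (q : ℕ → Prop) [DecidablePred q] : S.filter q ⊆ S := Finset.filter_subset _ _
  have hS1 : S ⊆ Finset.Icc 1 T := hS.trans (Finset.Icc_subset_Icc_left one_le_two)
  have hvar : ∑ t ∈ S with p t, gap 𝒜 μ (a t) ≤ _ :=
    sum_gap_le_of_sq_le_var hm (fun i => hΓ0 i i) (by positivity) ((hsub p).trans hS1)
      (fun t ht => ha t (hsub p ht)) (fun t ht i _ => hN t (hsub p ht) i)
      (fun t ht => hpos t (hsub p ht)) fun t ht => (Finset.mem_filter.1 ht).2
  have hdev : ∑ t ∈ S with ¬ p t, gap 𝒜 μ (a t) ≤ _ :=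
    sum_gap_le_of_sq_le_dev (θ := 72 * f * γ) hm (fun i => hΓ0 i i) (by positivity)
      ((hsub _).trans hS1) (fun t ht => ha t (hsub _ ht)) (fun t ht i _ => hN t (hsub _ ht) i)
      (fun t ht => hpos t (hsub _ ht)) fun t ht => by
        have hp := not_le.1 (Finset.mem_filter.1 ht).2
        linarith [hsq t (hsub _ ht)]
  rw [← Finset.sum_filter_add_sum_filter_not S p]
  have hslack : 0 ≤ f * γ * m * complexity 𝒜 μ Γ := by positivity
  calc _ ≤ _ := add_le_add hvar hdev
    _ ≤ _ := by linarith

end GoodStages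

section Decomposition

variable {𝒜 : ActionSet d m} {μ : Fin d → ℝ}

theorem muHat_sub {a : ℕ → Finset (Fin d)} {t : ℕ} (μ : Fin d → ℝ) (x : ℕ → Fin d → ℝ)
    (hN : ∀ i, pulls a t i ≠ 0) (i : Fin d) :
    muHat a x t i - μ i = noiseSum μ a x t i / pulls a t i := by
  simpa [avgVec_dotProduct, meanReward] using sum_muHat_sub_meanReward μ x hN {i}

theorem regret_le_add_sum_gap (𝒜 : ActionSet d m) (μ : Fin d → ℝ) (a : ℕ → Finset (Fin d))
    (n T : ℕ) :
    regret 𝒜 μ a T ≤ regret 𝒜 μ a (min n T) +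
      ∑ t ∈ Finset.Icc 1 T with n < t ∧ 0 < gap 𝒜 μ (a t), gap 𝒜 μ (a t) := by
  have hinit : Finset.Icc 1 (min n T) = (Finset.Icc 1 T).filter fun t => ¬ n < t := by
    ext t
    simp only [Finset.mem_Icc, Finset.mem_filter, le_min_iff]
    omega
  rw [regret, regret, hinit, ← Finset.sum_filter_not_add_sum_filter (Finset.Icc 1 T) (n < ·),
    ← Finset.filter_filter, Finset.sum_filter (s := Finset.filter _ _)]
  gcongr with t
  split_ifs with h
  · exact le_rfl
  · exact not_lt.1 h

variable [mΩ : MeasurableSpace Ω] {ℱ : Filtration ℕ mΩ} {X : ℕ → Ω → Fin d → ℝ}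
  {Γ : Matrix (Fin d) (Fin d) ℝ} {lam : ℝ} {A : ℕ → Ω → Finset (Fin d)} {τ : Ω → ℕ} {ω : Ω}
  {t T : ℕ} {B : Finset (Fin d)}

namespace IsOLSUCB

theorem pulls_ne_zero (hA : IsOLSUCB 𝒜 Γ lam ℱ X A τ) (ht : τ ω < t) (i : Fin d) :
    pulls (fun s => A s ω) t i ≠ 0 := by
  obtain ⟨s, hs1, hsτ, hi⟩ := hA.init ω i
  exact Finset.card_ne_zero_of_mem
    (Finset.mem_filter.2 ⟨Finset.mem_Ico.2 ⟨hs1, hsτ.trans_lt ht⟩, hi⟩)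

theorem two_le_of_lt (hA : IsOLSUCB 𝒜 Γ lam ℱ X A τ) (hm : 1 ≤ m) (ht : τ ω < t) : 2 ≤ t := by
  obtain ⟨i, -⟩ : (A 1 ω).Nonempty :=
    Finset.card_pos.1 ((𝒜.card_eq _ (hA.mem 1 le_rfl ω)).symm ▸ hm)
  obtain ⟨s, hs1, hsτ, -⟩ := hA.init ω i
  omega

theorem gap_le_two_mul_bonus (hA : IsOLSUCB 𝒜 Γ lam ℱ X A τ) (hm : 1 ≤ m) (ht : τ ω < t)
    (htT : t ≤ T) (hB : B ∈ 𝒜.acts)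
    (hBmax : 𝒜.acts.sup' 𝒜.nonempty (meanReward μ) = meanReward μ B)
    (hpos : 0 < gap 𝒜 μ (A t ω)) (hB_opt : ω ∉ pessimismEvent m Γ lam X μ A B t)
    (hdev : ∀ i ∈ A t ω, ω ∉ deviationEvent X μ A T (gapMin 𝒜 μ / (2 * m)) i
      (pulls (fun s => A s ω) t i)) :
    gap 𝒜 μ (A t ω) ≤ 2 * bonus m Γ lam (fun s => A s ω) t (A t ω) := by
  have hmem := hA.mem t ((hA.two_le_of_lt hm ht).trans' one_le_two) ω
  have hN := hA.pulls_ne_zero ht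
  have hindex : meanReward μ B ≤ index m Γ lam (fun s => A s ω) (fun s => X s ω) t (A t ω) :=
    (not_lt.1 fun h => hB_opt ⟨hN, h⟩).trans (hA.argmax ω t ht B hB)
  have hmuHat : ∀ i ∈ A t ω, muHat (fun s => A s ω) (fun s => X s ω) t i ≤
      μ i + gapMin 𝒜 μ / (2 * m) := by
    intro i hi
    have hNi : (0 : ℝ) < pulls (fun s => A s ω) t i := by
      exact_mod_cast Nat.pos_of_ne_zero (hN i)
    rw [← sub_le_iff_le_add', muHat_sub μ _ hN i, div_le_iff₀' hNi]
    exact (not_le.1 fun h => hdev i hi ⟨t, htT, rfl, h⟩).le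
  have hsum : ∑ i ∈ A t ω, muHat (fun s => A s ω) (fun s => X s ω) t i ≤
      meanReward μ (A t ω) + gapMin 𝒜 μ / 2 := by
    refine (Finset.sum_le_sum hmuHat).trans_eq ?_
    rw [Finset.sum_add_distrib, Finset.sum_const, 𝒜.card_eq _ hmem, nsmul_eq_mul, meanReward]
    field_simp
  have hgap : gap 𝒜 μ (A t ω) = meanReward μ B - meanReward μ (A t ω) := by rw [gap, hBmax]
  unfold index at hindex
  linarith [gapMin_le hmem hpos]

theorem one_le_sum_indicator (hA : IsOLSUCB 𝒜 Γ lam ℱ X A τ) (hm : 1 ≤ m) (ht : τ ω < t)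
    (htT : t ≤ T) (hB : B ∈ 𝒜.acts)
    (hBmax : 𝒜.acts.sup' 𝒜.nonempty (meanReward μ) = meanReward μ B)
    (hpos : 0 < gap 𝒜 μ (A t ω))
    (hbad : ¬ gap 𝒜 μ (A t ω) ≤ 2 * bonus m Γ lam (fun s => A s ω) t (A t ω)) :
    1 ≤ ∑ i ∈ A t ω, (deviationEvent X μ A T (gapMin 𝒜 μ / (2 * m)) i
          (pulls (fun s => A s ω) t i)).indicator (fun _ => (1 : ℝ)) ω +
        (pessimismEvent m Γ lam X μ A B t).indicator (fun _ => (1 : ℝ)) ω := by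
  have hind (s : Set Ω) : 0 ≤ s.indicator (fun _ => (1 : ℝ)) ω :=
    Set.indicator_nonneg (fun _ _ => zero_le_one) ω
  by_cases hopt : ω ∈ pessimismEvent m Γ lam X μ A B t
  · rw [Set.indicator_of_mem hopt]
    exact le_add_of_nonneg_left (Finset.sum_nonneg fun i _ => hind _)
  · obtain ⟨i, hi, hdev⟩ : ∃ i ∈ A t ω, ω ∈ deviationEvent X μ A T (gapMin 𝒜 μ / (2 * m)) i
        (pulls (fun s => A s ω) t i) := by
      by_contra! hdev
      exact hbad (hA.gap_le_two_mul_bonus hm ht htT hB hBmax hpos hopt hdev)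
    refine le_add_of_le_of_nonneg ?_ (hind _)
    refine (Set.indicator_of_mem hdev fun _ => (1 : ℝ)).ge.trans ?_
    exact Finset.single_le_sum (f := fun i => (deviationEvent X μ A T (gapMin 𝒜 μ / (2 * m)) i
      (pulls (fun s => A s ω) t i)).indicator (fun _ => (1 : ℝ)) ω) (fun j _ => hind _) hi

theorem sum_gap_le_mul_sum_indicator (hA : IsOLSUCB 𝒜 Γ lam ℱ X A τ) (hm : 1 ≤ m)
    (hB : B ∈ 𝒜.acts) (hBmax : 𝒜.acts.sup' 𝒜.nonempty (meanReward μ) = meanReward μ B)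
    {S : Finset ℕ} (hS : S ⊆ Finset.Icc 2 T) (hτ : ∀ t ∈ S, τ ω < t)
    (hpos : ∀ t ∈ S, 0 < gap 𝒜 μ (A t ω))
    (hbad : ∀ t ∈ S, ¬ gap 𝒜 μ (A t ω) ≤ 2 * bonus m Γ lam (fun s => A s ω) t (A t ω)) :
    ∑ t ∈ S, gap 𝒜 μ (A t ω) ≤ gapMax 𝒜 μ *
      (∑ i, ∑ n ∈ Finset.Icc 1 T,
        (deviationEvent X μ A T (gapMin 𝒜 μ / (2 * m)) i n).indicator (fun _ => (1 : ℝ)) ω +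
      ∑ t ∈ Finset.Icc 2 T,
        (pessimismEvent m Γ lam X μ A B t).indicator (fun _ => (1 : ℝ)) ω) := by
  have hind (s : Set Ω) : 0 ≤ s.indicator (fun _ => (1 : ℝ)) ω :=
    Set.indicator_nonneg (fun _ _ => zero_le_one) ω
  set E := fun i n => (deviationEvent X μ A T (gapMin 𝒜 μ / (2 * m)) i n).indicator
    (fun _ => (1 : ℝ)) ω
  set F := fun t => (pessimismEvent m Γ lam X μ A B t).indicator (fun _ => (1 : ℝ)) ω
  calc ∑ t ∈ S, gap 𝒜 μ (A t ω)
      ≤ ∑ t ∈ S, gapMax 𝒜 μ *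
          (∑ i ∈ A t ω, E i (pulls (fun s => A s ω) t i) + F t) := by
        refine Finset.sum_le_sum fun t ht => ?_
        obtain ⟨ht2, htT⟩ := Finset.mem_Icc.1 (hS ht)
        exact (gap_le_gapMax (hA.mem t (by omega) ω)).trans
          (le_mul_of_one_le_right gapMax_nonneg
            (hA.one_le_sum_indicator hm (hτ t ht) htT hB hBmax (hpos t ht) (hbad t ht)))
    _ = gapMax 𝒜 μ * (∑ t ∈ S, ∑ i ∈ A t ω, E i (pulls (fun s => A s ω) t i) +
          ∑ t ∈ S, F t) := by rw [← Finset.mul_sum, Finset.sum_add_distrib]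
    _ ≤ _ := by
        refine mul_le_mul_of_nonneg_left (add_le_add ?_ ?_) gapMax_nonneg
        · exact sum_apply_pulls_le (hS.trans (Finset.Icc_subset_Icc_left one_le_two))
            (fun _ _ => Finset.subset_univ _) (fun t ht i _ => hA.pulls_ne_zero (hτ t ht) i)
            fun i _ n => hind _
        · exact Finset.sum_le_sum_of_subset_of_nonneg hS fun t _ _ => hind _

theorem regret_le (hA : IsOLSUCB 𝒜 Γ lam ℱ X A τ) (hm : 1 ≤ m) (hΓ : Γ.PosSemidef)
    (hΓ0 : ∀ i j, 0 ≤ Γ i j) (hlam : 0 ≤ lam) (hB : B ∈ 𝒜.acts)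
    (hBmax : 𝒜.acts.sup' 𝒜.nonempty (meanReward μ) = meanReward μ B) (T : ℕ) (ω : Ω) :
    regret 𝒜 μ (fun t => A t ω) T ≤ regret 𝒜 μ (fun t => A t ω) (min (τ ω) T) +
      16 * max (explore m lam T) 0 * complexity 𝒜 μ Γ *
        (5 * (lam + 1 - maxCorr Γ (fun t => A t ω) T) * (posCeil (Real.log m / 1.6) : ℝ) ^ 2
          + 45 * maxCorr Γ (fun t => A t ω) T * m) +
      gapMax 𝒜 μ * (∑ i, ∑ n ∈ Finset.Icc 1 T,
          (deviationEvent X μ A T (gapMin 𝒜 μ / (2 * m)) i n).indicator (fun _ => (1 : ℝ)) ω +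
        ∑ t ∈ Finset.Icc 2 T,
          (pessimismEvent m Γ lam X μ A B t).indicator (fun _ => (1 : ℝ)) ω) := by
  classical
  set R := (Finset.Icc 1 T).filter fun t => τ ω < t ∧ 0 < gap 𝒜 μ (A t ω)
  let good : ℕ → Prop := fun t =>
    gap 𝒜 μ (A t ω) ≤ 2 * bonus m Γ lam (fun s => A s ω) t (A t ω)
  have hR (q : ℕ → Prop) [DecidablePred q] (t : ℕ) (ht : t ∈ R.filter q) :
      t ∈ Finset.Icc 2 T ∧ τ ω < t ∧ 0 < gap 𝒜 μ (A t ω) := by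
    obtain ⟨hIcc, hτ, hpos⟩ := Finset.mem_filter.1 (Finset.mem_of_mem_filter t ht)
    exact ⟨Finset.mem_Icc.2 ⟨hA.two_le_of_lt hm hτ, (Finset.mem_Icc.1 hIcc).2⟩, hτ, hpos⟩
  have hgood : ∑ t ∈ R with good t, gap 𝒜 μ (A t ω) ≤ _ :=
    sum_gap_le_of_gap_le_two_mul_bonus (a := fun t => A t ω) hm hΓ hΓ0 hlam
      (fun t ht => (hR _ t ht).1)
      (fun t ht => hA.mem t (one_le_two.trans (Finset.mem_Icc.1 (hR _ t ht).1).1) ω)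
      (fun t ht => hA.pulls_ne_zero (hR _ t ht).2.1) (fun t ht => (hR _ t ht).2.2)
      fun t ht => (Finset.mem_filter.1 ht).2
  have hbad : ∑ t ∈ R with ¬ good t, gap 𝒜 μ (A t ω) ≤ _ :=
    hA.sum_gap_le_mul_sum_indicator hm hB hBmax (fun t ht => (hR _ t ht).1)
      (fun t ht => (hR _ t ht).2.1) (fun t ht => (hR _ t ht).2.2)
      fun t ht => (Finset.mem_filter.1 ht).2
  refine (regret_le_add_sum_gap 𝒜 μ (fun t => A t ω) (τ ω) T).trans ?_
  rw [add_assoc, ← Finset.sum_filter_add_sum_filter_not _ good]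
  gcongr

end IsOLSUCB

end Decomposition

section Expectation

variable [mΩ : MeasurableSpace Ω] {P : Measure Ω} {ℱ : Filtration ℕ mΩ}
  {𝒜 : ActionSet d m} {X : ℕ → Ω → Fin d → ℝ} {μ : Fin d → ℝ} {C Γ : Matrix (Fin d) (Fin d) ℝ}
  {lam : ℝ} {A : ℕ → Ω → Finset (Fin d)} {τ : Ω → ℕ} {B : Finset (Fin d)} {T : ℕ}

-- The events need not be measurable, so they are replaced by measurable hulls.
theorem exists_integrable_sum_indicator_le [IsFiniteMeasure P] {ι : Type*} (s : Finset ι)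
    (E : ι → Set Ω) :
    ∃ g : Ω → ℝ, Integrable g P ∧ (∀ ω, ∑ i ∈ s, (E i).indicator (fun _ => 1) ω ≤ g ω) ∧
      ∫ ω, g ω ∂P = ∑ i ∈ s, P.real (E i) := by
  have hint (i : ι) : Integrable ((toMeasurable P (E i)).indicator fun _ => (1 : ℝ)) P :=
    (integrable_const 1).indicator (measurableSet_toMeasurable P (E i))
  refine ⟨fun ω => ∑ i ∈ s, (toMeasurable P (E i)).indicator (fun _ => 1) ω,
    integrable_finsetSum s fun i _ => hint i, fun ω => Finset.sum_le_sum fun i _ =>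
      Set.indicator_le_indicator_of_subset (subset_toMeasurable P (E i))
        (fun _ => zero_le_one) ω, ?_⟩
  rw [integral_finsetSum s fun i _ => hint i]
  refine Finset.sum_congr rfl fun i _ => ?_
  rw [integral_indicator_const _ (measurableSet_toMeasurable P (E i)), smul_eq_mul, mul_one,
    measureReal_def, measure_toMeasurable, measureReal_def]

variable [IsProbabilityMeasure P]

theorem integrable_of_finite_range {f : Ω → ℝ} (hf : Measurable f) (hfin : (Set.range f).Finite) :
    Integrable f P := by
  obtain ⟨c, hc⟩ := (hfin.image norm).bddAbove
  exact .of_bound hf.aestronglyMeasurable c (.of_forall fun ω => hc ⟨f ω, ⟨ω, rfl⟩, rfl⟩)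

namespace IsSubgaussianProcess

theorem sum_measure_pessimismEvent_le (hX : IsSubgaussianProcess P ℱ X μ C)
    (hA : ∀ t B, MeasurableSet[ℱ t] {ω | A (t + 1) ω = B}) (hCΓ : LePos C Γ) (hlam : 0 < lam)
    (hB : B.card = m) (T : ℕ) :
    ∑ t ∈ Finset.Icc 2 T, P.real (pessimismEvent m Γ lam X μ A B t) ≤ 3 := by
  have hsub : Finset.Icc 2 T ⊆ insert 2 (Finset.Icc 3 T) := by
    intro t ht
    simp only [Finset.mem_insert, Finset.mem_Icc] at *
    omega
  have htail : ∑ t ∈ Finset.Icc 3 T, P.real (pessimismEvent m Γ lam X μ A B t) ≤ 2 :=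
    (Finset.sum_le_sum fun t ht => ENNReal.toReal_le_of_le_ofReal (by positivity)
      (hX.measure_pessimismEvent_le hA hCΓ hlam hB (Finset.mem_Icc.1 ht).1)).trans
      (sum_inv_mul_log_sq_le T)
  calc ∑ t ∈ Finset.Icc 2 T, P.real (pessimismEvent m Γ lam X μ A B t)
      ≤ ∑ t ∈ insert 2 (Finset.Icc 3 T), P.real (pessimismEvent m Γ lam X μ A B t) :=
        Finset.sum_le_sum_of_subset_of_nonneg hsub fun _ _ _ => measureReal_nonneg
    _ = P.real (pessimismEvent m Γ lam X μ A B 2) +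
        ∑ t ∈ Finset.Icc 3 T, P.real (pessimismEvent m Γ lam X μ A B t) :=
        Finset.sum_insert (by simp)
    _ ≤ 1 + 2 := add_le_add measureReal_le_one htail
    _ = 3 := by norm_num

theorem sum_sum_measure_deviationEvent_le (hX : IsSubgaussianProcess P ℱ X μ C)
    (hA : ∀ t B, MeasurableSet[ℱ t] {ω | A (t + 1) ω = B}) {ε : ℝ} (hε : 0 < ε) (T : ℕ) :
    ∑ i, ∑ n ∈ Finset.Icc 1 T, P.real (deviationEvent X μ A T ε i n) ≤
      d * (2 * (⨆ i, C i i) / ε ^ 2) :=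
  calc _ ≤ ∑ _i : Fin d, 2 * (⨆ i, C i i) / ε ^ 2 := by
        refine Finset.sum_le_sum fun i _ => (hX.sum_measure_deviationEvent_le hA hε i T).trans ?_
        gcongr
        exact le_ciSup (f := fun i => C i i) (Set.finite_range _).bddAbove i
    _ = d * (2 * (⨆ i, C i i) / ε ^ 2) := by
        rw [Finset.sum_const, Finset.card_univ, Fintype.card_fin, nsmul_eq_mul]

end IsSubgaussianProcess

theorem dependsOn_gap (𝒜 : ActionSet d m) (μ : Fin d → ℝ) {t : ℕ} (ht : t ∈ Finset.Icc 1 T) :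
    DependsOn (fun a : ℕ → Finset (Fin d) => gap 𝒜 μ (a t)) (Set.Icc 1 T) := fun _ _ h =>
  congrArg (gap 𝒜 μ) (h t (Finset.mem_Icc.1 ht))

theorem dependsOn_maxCorr (Γ : Matrix (Fin d) (Fin d) ℝ) (T : ℕ) :
    DependsOn (fun a => maxCorr Γ a T) (Set.Icc 1 T) := fun _ _ h =>
  iSup_congr fun t => by rw [h t (Finset.mem_Icc.1 t.2)]

namespace IsOLSUCB

theorem integrable_of_dependsOn (hA : IsOLSUCB 𝒜 Γ lam ℱ X A τ)
    {H : (ℕ → Finset (Fin d)) → ℝ} (hH : DependsOn H (Set.Icc 1 T)) :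
    Integrable (fun ω => H fun s => A s ω) P :=
  integrable_of_finite_range
    ((measurable_of_dependsOn_actions (n := T) hA.predictable fun _ _ h =>
      hH fun s hs => h s ⟨hs.1, hs.2.trans (Nat.le_succ T)⟩).mono (ℱ.le T) le_rfl)
    (finite_range_of_dependsOn_actions hH A)

theorem integrable_regret (hA : IsOLSUCB 𝒜 Γ lam ℱ X A τ) (μ : Fin d → ℝ) (T : ℕ) :
    Integrable (fun ω => regret 𝒜 μ (fun t => A t ω) T) P :=
  integrable_finsetSum _ fun _ ht => hA.integrable_of_dependsOn (dependsOn_gap 𝒜 μ ht)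

theorem integrable_regret_min (hA : IsOLSUCB 𝒜 Γ lam ℱ X A τ) (μ : Fin d → ℝ) (T : ℕ) :
    Integrable (fun ω => regret 𝒜 μ (fun t => A t ω) (min (τ ω) T)) P := by
  have hsum (ω : Ω) : regret 𝒜 μ (fun t => A t ω) (min (τ ω) T) =
      ∑ t ∈ Finset.Icc 1 T, {ω | τ ω ≤ t - 1}ᶜ.indicator (fun ω => gap 𝒜 μ (A t ω)) ω := by
    have hIcc : Finset.Icc 1 (min (τ ω) T) =
        (Finset.Icc 1 T).filter fun t => ¬ τ ω ≤ t - 1 := by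
      ext t
      simp only [Finset.mem_Icc, Finset.mem_filter, le_min_iff]
      omega
    rw [regret, hIcc, Finset.sum_filter]
    exact Finset.sum_congr rfl fun t _ => by simp [Set.indicator_apply]
  simp_rw [hsum]
  exact integrable_finsetSum _ fun t ht =>
    (hA.integrable_of_dependsOn (dependsOn_gap 𝒜 μ ht)).indicator
      (ℱ.le _ _ (hA.stopping (t - 1))).compl

theorem integrable_linear_maxCorr (hA : IsOLSUCB 𝒜 Γ lam ℱ X A τ) (T : ℕ) (r s : ℝ) :
    Integrable (fun ω => 5 * (lam + 1 - maxCorr Γ (fun t => A t ω) T) * r +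
      45 * maxCorr Γ (fun t => A t ω) T * s) P := by
  have hγ : Integrable (fun ω => maxCorr Γ (fun t => A t ω) T) P :=
    hA.integrable_of_dependsOn (dependsOn_maxCorr Γ T)
  exact ((((integrable_const (lam + 1)).sub hγ).const_mul 5).mul_const r).add
    ((hγ.const_mul 45).mul_const s)

theorem integral_regret_le (hA : IsOLSUCB 𝒜 Γ lam ℱ X A τ) (hm : 1 ≤ m) (hΓ : Γ.PosSemidef)
    (hΓ0 : ∀ i j, 0 ≤ Γ i j) (hlam : 0 ≤ lam) (hB : B ∈ 𝒜.acts)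
    (hBmax : 𝒜.acts.sup' 𝒜.nonempty (meanReward μ) = meanReward μ B) (T : ℕ) :
    ∫ ω, regret 𝒜 μ (fun t => A t ω) T ∂P ≤
      ∫ ω, regret 𝒜 μ (fun t => A t ω) (min (τ ω) T) ∂P +
      16 * max (explore m lam T) 0 * complexity 𝒜 μ Γ *
        ∫ ω, (5 * (lam + 1 - maxCorr Γ (fun t => A t ω) T) * (posCeil (Real.log m / 1.6) : ℝ) ^ 2
          + 45 * maxCorr Γ (fun t => A t ω) T * m) ∂P +
      gapMax 𝒜 μ * (∑ i, ∑ n ∈ Finset.Icc 1 T,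
          P.real (deviationEvent X μ A T (gapMin 𝒜 μ / (2 * m)) i n) +
        ∑ t ∈ Finset.Icc 2 T, P.real (pessimismEvent m Γ lam X μ A B t)) := by
  obtain ⟨g, hg, hdev_le, hg_eq⟩ := exists_integrable_sum_indicator_le (P := P)
    (Finset.univ ×ˢ Finset.Icc 1 T)
    fun p : Fin d × ℕ => deviationEvent X μ A T (gapMin 𝒜 μ / (2 * m)) p.1 p.2
  obtain ⟨h, hh, hpess_le, hh_eq⟩ := exists_integrable_sum_indicator_le (P := P)
    (Finset.Icc 2 T) (pessimismEvent m Γ lam X μ A B)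
  simp only [Finset.sum_product] at hdev_le hg_eq
  have hinit := hA.integrable_regret_min (P := P) μ T
  have hcorr := (hA.integrable_linear_maxCorr (P := P) T
    ((posCeil (Real.log m / 1.6) : ℝ) ^ 2) m).const_mul
      (16 * max (explore m lam T) 0 * complexity 𝒜 μ Γ)
  have hgh : Integrable (fun ω => gapMax 𝒜 μ * (g ω + h ω)) P := (hg.add hh).const_mul _
  rw [← hg_eq, ← hh_eq, ← integral_add hg hh, ← integral_const_mul, ← integral_const_mul,
    ← integral_add hinit hcorr, ← integral_add (by exact hinit.add hcorr) hgh]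
  refine integral_mono (hA.integrable_regret μ T) ((hinit.add hcorr).add hgh) fun ω => ?_
  exact (hA.regret_le hm hΓ hΓ0 hlam hB hBmax T ω).trans (add_le_add_right
    (mul_le_mul_of_nonneg_left (add_le_add (hdev_le ω) (hpess_le ω)) gapMax_nonneg) _)

end IsOLSUCB

end Expectation

end SemiBandit

end

open SemiBandit

theorem theorem2_general {d m : ℕ} (hm : 1 ≤ m) {Ω : Type*} [mΩ : MeasurableSpace Ω]
    (P : Measure Ω) [IsProbabilityMeasure P] (ℱ : Filtration ℕ mΩ)
    (𝒜 : ActionSet d m) (μ : Fin d → ℝ) (C Γ : Matrix (Fin d) (Fin d) ℝ)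
    (X : ℕ → Ω → Fin d → ℝ) (hX : IsSubgaussianProcess P ℱ X μ C)
    (hΓ : Γ.PosSemidef) (hΓ0 : ∀ i j, 0 ≤ Γ i j) (hCΓ : LePos C Γ)
    (lam : ℝ) (hlam : 0 < lam) (A : ℕ → Ω → Finset (Fin d)) (τ : Ω → ℕ)
    (hA : IsOLSUCB 𝒜 Γ lam ℱ X A τ) (T : ℕ) :
    ∫ ω, regret 𝒜 μ (fun t => A t ω) T ∂P ≤
      ∫ ω, regret 𝒜 μ (fun t => A t ω) (min (τ ω) T) ∂P
      + 16 * max (explore m lam T) 0 * complexity 𝒜 μ Γ *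
          ∫ ω, (5 * (lam + 1 - maxCorr Γ (fun t => A t ω) T) *
                (posCeil (Real.log m / 1.6) : ℝ) ^ 2
              + 45 * maxCorr Γ (fun t => A t ω) T * m) ∂P
      + 8 * d * (m : ℝ) ^ 2 * (⨆ i, C i i) * gapMax 𝒜 μ / gapMin 𝒜 μ ^ 2
      + 4 * gapMax 𝒜 μ := by
  obtain ⟨B, hB, hBmax⟩ := 𝒜.acts.exists_mem_eq_sup' 𝒜.nonempty (meanReward μ)
  have hregret := hA.integral_regret_le (P := P) hm hΓ hΓ0 hlam.le hB hBmax T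
  rcases (posGaps 𝒜 μ).eq_empty_or_nonempty with hnone | hsome
  · simpa [gapMax_eq_zero hnone] using hregret
  have hmin : 0 < gapMin 𝒜 μ := gapMin_pos 𝒜 μ hsome
  have hmax : 0 ≤ gapMax 𝒜 μ := gapMax_nonneg
  have hdev := hX.sum_sum_measure_deviationEvent_le hA.predictable
    (ε := gapMin 𝒜 μ / (2 * m)) (by positivity) T
  have hpess := hX.sum_measure_pessimismEvent_le hA.predictable hCΓ hlam (𝒜.card_eq B hB) T
  have hevents := mul_le_mul_of_nonneg_left (add_le_add hdev hpess) hmax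
  have hcoeff : gapMax 𝒜 μ * (d * (2 * (⨆ i, C i i) / (gapMin 𝒜 μ / (2 * m)) ^ 2) + 3) =
      8 * d * (m : ℝ) ^ 2 * (⨆ i, C i i) * gapMax 𝒜 μ / gapMin 𝒜 μ ^ 2 + 3 * gapMax 𝒜 μ := by
    field_simp
    ring
  linarith

theorem theorem2 {d m : ℕ} (hm : 1 ≤ m) {Ω : Type*} [mΩ : MeasurableSpace Ω]
    (P : Measure Ω) [IsProbabilityMeasure P] (ℱ : Filtration ℕ mΩ)
    (𝒜 : SemiBandit.ActionSet d m) (μ : Fin d → ℝ) (C Γ : Matrix (Fin d) (Fin d) ℝ)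
    (X : ℕ → Ω → Fin d → ℝ) (hX : SemiBandit.IsRewardProcess P ℱ X μ C)
    (hΓ : Γ.PosSemidef) (hΓ0 : ∀ i j, 0 ≤ Γ i j) (hCΓ : SemiBandit.LePos C Γ)
    (lam : ℝ) (hlam : 0 < lam) (A : ℕ → Ω → Finset (Fin d)) (τ : Ω → ℕ)
    (hA : SemiBandit.IsOLSUCB 𝒜 Γ lam ℱ X A τ) (T : ℕ) (hT : 1 ≤ T) :
    ∫ ω, SemiBandit.regret 𝒜 μ (fun t => A t ω) T ∂P ≤
      ∫ ω, SemiBandit.regret 𝒜 μ (fun t => A t ω) (min (τ ω) T) ∂P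
      + 16 * max (SemiBandit.explore m lam T) 0 * SemiBandit.complexity 𝒜 μ Γ *
          ∫ ω, (5 * (lam + 1 - SemiBandit.maxCorr Γ (fun t => A t ω) T) *
                (SemiBandit.posCeil (Real.log m / 1.6) : ℝ) ^ 2
              + 45 * SemiBandit.maxCorr Γ (fun t => A t ω) T * m) ∂P
      + 8 * d * (m : ℝ) ^ 2 * (⨆ i, C i i) * SemiBandit.gapMax 𝒜 μ / SemiBandit.gapMin 𝒜 μ ^ 2
      + 4 * SemiBandit.gapMax 𝒜 μ :=
  theorem2_general hm P ℱ 𝒜 μ C Γ X hX.isSubgaussianProcess hΓ hΓ0 hCΓ lam hlam A τ hA T
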